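/- **Model.** A network is a finite connected undirected graph $G$ of diameter $D$, whose nodes have distinct IDs in $\{0,\dots,L-1\}$. Time is divided into synchronous steps, and all nodes start at time $0$. In each step every node, depending deterministically on its initial knowledge and on what it has heard so far, either beeps, or listens, or has terminated with an output. A listening node hears a beep iff at least one neighbour beeps (it cannot tell how many); a beeping node hears nothing. A nonempty set $S$ of $k$ nodes are sources; each source $s$ holds a message $m(s)\in\{0,\dots,M-1\}$. Initially a node knows only its own ID, whether it is a source and, if so, its message; it knows none of $G,D,L,M,k$. *Multi-broadcast with provenance* is performed within $T$ time-steps if after $T$ steps every node has terminated with output $\{(\mathrm{ID}(s),m(s)) : s\in S\}$. **Algorithm** *Multi-Broadcast With Provenance*. Write $C(x)$ for the bit string $x$ with every bit doubled and $10$ put in front and behind. *Beep-Wave*$(v,x)$: $v$ beeps in step $3i$ iff bit $i$ of $C(x)$ is $1$; any other node that hears a beep in step $i$ beeps in step $i+1$ unless it beeped in step $i-1$, and it decodes $x$. 1. *ElectLeader*: a leader election algorithm as in part (a) below gives the leader $v$, the node with the highest ID; let $b$ be the number of bits of this ID. 2. *EstimateDiameter*$(v)$: $v$ sends a beep through the network,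 every node sends an acknowledgement back (relayed towards $v$ only, in time slots modulo $3$), and the step in which the acknowledgements have ceased at $v$ is sent out by Beep-Wave and is used from then on as a common upper bound on $D$. 3. *GetMessageLength*: the strings $1^{|m(s)|}$, $s\in S$, are collected at $v$ as in *CollectMessages*, and $w=\max_s|m(s)|$ is sent out by Beep-Wave. 4. For $i=1,\dots,b$: let $p_1<\dots<p_{k_i}$ be the known $(i-1)$-bit prefixes of source IDs (written with $b$ bits). *CollectMessages* gives $v$ the bitwise OR of the strings $Z_s$, $s\in S$, of length $2k_i$, where the positions of $Z_s$ correspond to $p_10,p_11,\dots,p_{k_i}0,p_{k_i}1$ and $Z_s$ has a $1$ exactly at the $i$-bit prefix of the ID of $s$. Beep-Wave sends the OR to all nodes, which thus know the $i$-bit prefixes. (*CollectMessages*: after a Beep-Wave of a single bit from $v$, which tells each node its distance from $v$, bits are relayed towards $v$ in slots modulo $3$ such that equal positions arrive together.) 5. With *CollectMessages* $v$ obtains the string of $k$ blocks of $w$ bits whose $j$-th block is the message of the source with the $j$-th smallest ID; Beep-Wave sends it to all nodes, which output the pairs. **Theorem.** (a) There is a leader election algorithm, i.e. a deterministic algorithm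 in which a node initially knows only its ID and in which, on every network as above, all nodes terminate in the same time-step with the highest ID as output, within $O(D\log L)$ time-steps (for one-node networks, $O(\log L+1)$). (b) For every such algorithm *ElectLeader* there is a constant $c$ such that on every network, for every nonempty set of $k$ sources and all messages as above with $LM\ge 2k$ (which always holds if $M\ge 2$), *Multi-Broadcast With Provenance* performs multi-broadcast with provenance within $$c\left(k\log_2\frac{LM}{k}+D\log_2 L\right)$$ time-steps. -/

import Mathlib

namespace Beep

/-! ### The beep model -/

/-- What a node does in a time-step: beep, or listen; or it has terminated with an output. -/
inductive Action (α : Type) where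
  | beep : Action α
  | listen : Action α
  | halt (a : α) : Action α

/-- A deterministic node program. It maps what the node has heard in the time-steps so far
(oldest first; `true` is a beep, `false` is silence or a time-step in which the node itself beeped)
to the next action. The length of that list is the node's clock. -/
def Program (α : Type) : Type := List Bool → Action α

/-- `runHistory G P t v` is what node `v` has heard during the first `t` time-steps if every node
`w` of the network `G` runs the program `P w`. A listening node hears a beep iff at least one of its
neighbours beeps. The list of a terminated node does not grow any more. -/
noncomputable def runHistory {V α : Type} (G : SimpleGraph V) (P : V → Program α) :
    ℕ → V → List Bool
  | 0, _ => []
  | t + 1, v =>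
    match P v (runHistory G P t v) with
    | .halt _ => runHistory G P t v
    | .beep => runHistory G P t v ++ [false]
    | .listen =>
      open Classical in
      runHistory G P t v ++ [decide (∃ w, G.Adj v w ∧ P w (runHistory G P t w) = .beep)]

/-- After `T` time-steps node `v` has terminated with output `a`. -/
def HasOutput {V α : Type} (G : SimpleGraph V) (P : V → Program α) (T : ℕ) (v : V) (a : α) : Prop :=
  P v (runHistory G P T v) = .halt a

/-- Node `v` terminates with output `a` after exactly `T` time-steps. -/
def HaltsAt {V α : Type} (G : SimpleGraph V) (P : V → Program α) (T : ℕ) (v : V) (a : α) : Prop :=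
  HasOutput G P T v a ∧ (runHistory G P T v).length = T

/-! ### Sequential composition of programs -/

/-- Run `p`; when it terminates with output `a`, continue (in the same time-step, with a fresh
clock) with `f a`. -/
def Program.andThen {α β : Type} (f : α → Program β) : Program α → List Bool → Action β
  | p, [] =>
    match p [] with
    | .beep => .beep
    | .listen => .listen
    | .halt a => f a []
  | p, b :: h =>
    match p [] with
    | .halt a => f a (b :: h)
    | _ => Program.andThen f (fun l => p (b :: l)) h

instance : Monad Program where
  pure a := fun _ => Action.halt a
  bind p f := Program.andThen f p

/-- Was a beep heard in time-step `t`? -/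
def heard (h : List Bool) (t : ℕ) : Bool := h.getD t false

/-- In a program that beeps according to the rule `rule`: the last three time-steps have passed
without a beep heard or made by the node. -/
def quiet (rule : List Bool → Bool) (h : List Bool) : Bool :=
  decide (3 ≤ h.length) &&
    (List.range h.length).all fun t =>
      decide (t + 3 < h.length) || (!heard h t && !rule (h.take t))

/-- Beep or listen. -/
def act {α : Type} (b : Bool) : Action α := if b then .beep else .listen

/-! ### Bit strings -/

/-- The `w`-bit binary representation of `x`, most significant bit first. -/
def toBits (w x : ℕ) : List Bool := (List.range w).map fun i => x.testBit (w - 1 - i)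

/-- The number represented by a bit string, most significant bit first. -/
def ofBits (l : List Bool) : ℕ := l.foldl (fun a b => 2 * a + b.toNat) 0

/-- The self-delimiting code: double every bit and put `10` at the beginning and at the end. -/
def encode (m : List Bool) : List Bool :=
  [true, false] ++ m.flatMap (fun b => [b, b]) ++ [true, false]

/-- Read doubled bits up to the closing `10`. -/
def decodeBody : List Bool → Option (List Bool)
  | true :: false :: _ => some []
  | b :: _ :: l => (decodeBody l).map (b :: ·)
  | _ => none

/-- Inverse of `encode`; `none` as long as the closing `10` has not been read. -/
def decode : List Bool → Option (List Bool)
  | true :: false :: l => decodeBody l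
  | _ => none

/-- Every third entry of a list, starting with the first. -/
def everyThird : List Bool → List Bool
  | a :: _ :: _ :: l => a :: everyThird l
  | a :: _ => [a]
  | [] => []

/-! ### Beep waves -/

/-- The relay rule of beep waves, for a history with the latest time-step first: beep in time-step
`t` iff a beep was heard in time-step `t - 1` and the node did not beep in time-step `t - 2`. -/
def relayRev : List Bool → Bool
  | [] => false
  | [x] => x
  | x :: _ :: l => x && !relayRev l

/-- The message received in a beep wave so far: one bit every three time-steps, from the first
beep on. -/
def received (h : List Bool) : Option (List Bool) := decode (everyThird (h.drop (h.idxOf true)))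

/-- Beep wave carrying `m` from the source: the source beeps in time-step `3 * i` iff bit `i` of
`encode m` is `1`, all other nodes relay. A node that knows the message `m` terminates when its
clock shows `deadline m`. The output is the message and the distance from the source, as the node
infers it from the arrival of the first beep. -/
def beepWave (isSource : Bool) (m : List Bool) (deadline : List Bool → ℕ) :
    Program (List Bool × ℕ) := fun h =>
  if isSource then
    if deadline m ≤ h.length then .halt (m, 0)
    else act (h.length % 3 == 0 && (encode m).getD (h.length / 3) false)
  else
    match received h with
    | some m' =>
      if deadline m' ≤ h.length then .halt (m', h.idxOf true + 1) else act (relayRev h.reverse)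
    | none => act (relayRev h.reverse)

/-- The duration of a beep wave carrying `m` in a network of diameter at most `D`. -/
def waveTime (D : ℕ) (m : List Bool) : ℕ := 3 * (encode m).length + D

/-! ### Diameter estimation -/

/-- The leader beeps in time-step `1`. Another node that hears its first beep in time-step `j`
relays it in time-step `j + 1`, beeps an acknowledgement in the next time-step congruent to `-j`
modulo `3`, and relays what it hears in time-steps congruent to `2 - j` modulo `3` (these are
acknowledgements of nodes farther away from the leader). -/
def probeRule (isLeader : Bool) (h : List Bool) : Bool :=
  let t := h.length
  let j := h.idxOf true
  if isLeader then t == 1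
  else decide (j < t) &&
    (t == j + 1 || ((t + j) % 3 == 0 && (decide (t ≤ j + 3) || heard h (t - 1))))

/-- Follow `probeRule` until three time-steps have been quiet (for a node other than the leader:
after the first beep); the output is the number of the time-step. -/
def probe (isLeader : Bool) : Program ℕ := fun h =>
  if (isLeader || h.contains true) && quiet (probeRule isLeader) h then .halt h.length
  else act (probeRule isLeader h)

/-- All nodes obtain the time-step `D'` in which the leader stopped probing; the leader sends it in
a beep wave that starts in that time-step. All nodes terminate together. -/
def estimateDiameter (isLeader : Bool) : Program ℕ := do
  let t ← probe isLeader
  let (m, _) ← beepWave isLeader (toBits t.size t)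
    (fun m => ofBits m + waveTime (ofBits m) m - t)
  pure (ofBits m)

/-! ### Message collection -/

/-- A node at distance `dist ≥ 1` from the leader uses only the time-steps `3 * i + D - dist`. In
the `i`-th of them it beeps iff bit `i` of its own string is `1` or it has heard a beep in the
time-step before, which comes from the nodes at distance `dist + 1`. -/
def collectRule (D dist : ℕ) (bit : ℕ → Bool) (h : List Bool) : Bool :=
  let t := h.length
  decide (D ≤ t + dist) && (t + dist - D) % 3 == 0 &&
    (bit ((t + dist - D) / 3) || heard h (t - 1))

/-- The leader obtains the OR-superimposition of the strings `m`, of length at most `p`, of all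
nodes (a node that has nothing to send has a string of zeros); the output of the other nodes is
immaterial. -/
def collectMessages (isLeader : Bool) (D p : ℕ) (m : List Bool) : Program (List Bool) := do
  let (_, dist) ← beepWave isLeader [true] (waveTime D)
  fun h =>
    if 3 * p + D ≤ h.length then
      .halt ((List.range p).map fun i => m.getD i false || heard h (3 * i + D - 1))
    else act (!isLeader && collectRule D dist (fun i => m.getD i false) h)

/-- Collection of the strings `1 ^ len` of all nodes without a bound on `len`. The leader stops
after the first `0` of the superimposition, the other nodes when it has been quiet for three
time-steps. The output is the number of the time-step. -/
def collectOnes (isLeader : Bool) (D dist len : ℕ) : Program ℕ := fun h =>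
  if isLeader then
    if D + 3 ≤ h.length ∧ (h.length - D) % 3 = 0 ∧ len ≤ (h.length - D) / 3 - 1 ∧
        heard h (h.length - 4) = false then .halt h.length
    else .listen
  else
    if D + 3 ≤ h.length ∧ quiet (collectRule D dist (fun i => decide (i < len))) h = true then
      .halt h.length
    else act (collectRule D dist (fun i => decide (i < len)) h)

/-- All nodes learn the largest value `p` of `len`. All nodes terminate together. -/
def getMessageLength (isLeader : Bool) (D len : ℕ) : Program ℕ := do
  let (_, dist) ← beepWave isLeader [true] (waveTime D)
  let t ← collectOnes isLeader D dist len
  let p := (t - D) / 3 - 1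
  let (m, _) ← beepWave isLeader (toBits p.size p)
    (fun m => 3 * (ofBits m + 1) + D + waveTime D m - t)
  pure (ofBits m)

/-! ### Multi-broadcast with provenance -/

/-- The simultaneous binary searches for the source IDs. The first argument after `myPrefix` is the
number `r` of ID bits that are still unknown, the second the list of the known prefixes in
increasing order; `myPrefix r` is a source's ID without its last `r` bits and `none` for a node that
is not a source. -/
def searchIds (isLeader : Bool) (D : ℕ) (myPrefix : ℕ → Option ℕ) :
    ℕ → List ℕ → Program (List ℕ)
  | 0, known => pure known
  | r + 1, known => do
    let candidates := known.flatMap fun q => [2 * q, 2 * q + 1]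
    let Z ← collectMessages isLeader D candidates.length
      (candidates.map fun q => decide (myPrefix r = some q))
    let (Z, _) ← beepWave isLeader Z (waveTime D)
    searchIds isLeader D myPrefix r (((candidates.zip Z).filter fun c => c.2).map fun c => c.1)

/-- The program of the node with ID `myId` in *Multi-Broadcast With Provenance*; `msg` is the
message of a source and `none` for other nodes. `electLeader` is the leader election
subroutine. Nothing else is known to the node initially. -/
def multiBroadcastWithProvenance (electLeader : ℕ → Program ℕ) (myId : ℕ) (msg : Option ℕ) :
    Program (Finset (ℕ × ℕ)) := do
  let leaderId ← electLeader myId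
  let isLeader := myId == leaderId
  let D ← estimateDiameter isLeader
  let w ← getMessageLength isLeader D (msg.elim 0 Nat.size)
  let ids ← searchIds isLeader D (fun r => msg.map fun _ => myId / 2 ^ r) leaderId.size [0]
  let blocks := ids.flatMap fun q =>
    if q = myId then toBits w (msg.getD 0) else List.replicate w false
  let R ← collectMessages isLeader D (ids.length * w) blocks
  let (R, _) ← beepWave isLeader R (waveTime D)
  pure ((List.range ids.length).map fun i =>
    (ids.getD i 0, ofBits ((R.drop (i * w)).take w))).toFinset

/-! ### The tasks -/

/-- `electLeader` is a leader election algorithm with running time `O(D log L)` that needs no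
knowledge of the network: there is a constant `c` such that in every connected network with unique
IDs smaller than `L`, all nodes terminate together within that time and output the highest ID.
(The `+ 1` only matters for one-node networks, where `D = 0` and possibly `log L = 0`.) -/
def IsLeaderElection (electLeader : ℕ → Program ℕ) : Prop :=
  ∃ c : ℝ, ∀ (V : Type) [Fintype V] (G : SimpleGraph V) (ID : V → ℕ) (L : ℕ),
    G.Connected → Function.Injective ID → (∀ v, ID v < L) →
    ∃ (T : ℕ) (leader : V), (∀ v, ID v ≤ ID leader) ∧
      (T : ℝ) ≤ c * (((G.diam : ℝ) + 1) * (Real.logb 2 L + 1)) ∧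
      ∀ v, HaltsAt G (fun v => electLeader (ID v)) T v (ID leader)

/-- Within `T` time-steps, in the network `G` with sources `S`, IDs `ID` and source messages `m`,
every node outputs exactly the set of all (source ID, source message) pairs. The initial knowledge
of a node is its ID, whether it is a source, and in this case its message. -/
def PerformsMultiBroadcastWithin (alg : ℕ → Option ℕ → Program (Finset (ℕ × ℕ)))
    {V : Type} (G : SimpleGraph V) (ID : V → ℕ) (S : Finset V) (m : V → ℕ) (T : ℕ) : Prop :=
  ∀ v, HasOutput G (fun v => open Classical in alg (ID v) (if v ∈ S then some (m v) else none)) T v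
    (S.image fun s => (ID s, m s))

end Beep

/-! Each stage is analysed by guessing the beeps of the whole network in closed form, in terms of
distances, and checking that every node, fed with what it would then hear, acts as guessed;
induction on time makes the guess true (`haltsAt_of_pattern`). Stages that end everywhere in the
same time-step compose (`HaltsAt.bind`). Where nodes finish a stage at different times, a beep wave
restores a common clock (`bind_beepWave_haltsAt`).

Leader election (`isLeaderElection_elect`): let `2 ^ K` be the largest power of two not above the
bit length of the highest ID. Phase `p` costs `O(2 ^ p)`: it finds `K` and then the bits of the
highest ID, using floods of length `2 ^ (p - K)`, which is correct once this length reaches the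
diameter. Nodes cannot tell whether it does, so the result is verified, and verification is
all-or-nothing: success at one node forces correctness and success everywhere
(`eq_of_plausibleLeader`). The costs form a geometric series dominated by the first good phase,
which gives `O(D log L)`.

Multi-broadcast rests on time slots modulo 3: a node, its nearer and its farther neighbours use
three different residues, so waves run outwards without echo and collected bits run inwards along
geodesics. Diameter estimation and unary collection need no prior bound on what is sent: every node
beeps periodically until it stops for good, so three silent steps are a sound local stopping signal
(`silent_of_quiet`).

Running time: a search round costs `O(prefixes + D)`, and there are at most `min k (2 ^ j)` prefixes
of `j` bits, so all rounds together cost `O(k + k log (L / k) + D log L)` up to lower-order terms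
(`sum_card_prefixes_le`); the last collection adds `O(k log M + k + D)`. Since `2 k ≤ L M`, the
logarithm of `L M / k` is at least 1 and absorbs the terms `O(k)` (`running_time_le`). -/

namespace Beep

/-! ### Predicting the run of a network -/

/-- The list of the first `t` values of `f`. -/
def record (f : ℕ → Bool) (t : ℕ) : List Bool := (List.range t).map f

@[simp] theorem record_length (f : ℕ → Bool) (t : ℕ) : (record f t).length = t := by simp [record]

theorem record_succ (f : ℕ → Bool) (t : ℕ) : record f (t + 1) = record f t ++ [f t] := by
  simp [record, List.range_succ]

theorem record_take (f : ℕ → Bool) (s t : ℕ) : (record f t).take s = record f (min s t) := by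
  simp [record, ← List.map_take, List.take_range]

theorem record_take_of_le (f : ℕ → Bool) {s t : ℕ} (h : s ≤ t) :
    (record f t).take s = record f s := by rw [record_take, min_eq_left h]

theorem record_add (f : ℕ → Bool) (s t : ℕ) :
    record f (s + t) = record f s ++ record (fun i => f (s + i)) t := by
  simp [record, List.range_add]

theorem record_congr {f g : ℕ → Bool} {t : ℕ} (h : ∀ i < t, f i = g i) :
    record f t = record g t := by
  apply List.map_congr_left
  intro i hi
  exact h i (List.mem_range.1 hi)

theorem heard_record (f : ℕ → Bool) (t i : ℕ) :
    heard (record f t) i = (decide (i < t) && f i) := by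
  by_cases h : i < t <;> simp [heard, record, List.getD, h]

theorem contains_record (f : ℕ → Bool) (t : ℕ) :
    (record f t).contains true = true ↔ ∃ i < t, f i = true := by
  simp [record]

theorem idxOf_record_of_first {f : ℕ → Bool} {j t : ℕ} (hj : f j = true)
    (hf : ∀ i < j, f i = false) (h : j < t) : (record f t).idxOf true = j := by
  obtain ⟨d, rfl⟩ : ∃ d, t = j + (1 + d) := ⟨t - j - 1, by omega⟩
  rw [record_add, record_add, List.idxOf_append_of_notMem]
  · simp [record, hj]
  · simp only [record, List.mem_map, List.mem_range, not_exists, not_and]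
    intro i hi
    simp [hf i hi]

theorem idxOf_record_of_none {f : ℕ → Bool} {t : ℕ} (hf : ∀ i < t, f i = false) :
    (record f t).idxOf true = t := by
  rw [List.idxOf_of_notMem, record_length]
  simp only [record, List.mem_map, List.mem_range, not_exists, not_and]
  intro i hi
  simp [hf i hi]

section Run

variable {V α β : Type} {G : SimpleGraph V}

open Classical in
/-- What node `v` hears in time-step `t` if `B w t` tells whether `w` beeps in time-step `t`. -/
noncomputable def hears (G : SimpleGraph V) (B : V → ℕ → Bool) (v : V) (t : ℕ) : Bool :=
  !B v t && decide (∃ w, G.Adj v w ∧ B w t = true)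

theorem hears_eq_true {B : V → ℕ → Bool} {v : V} {t : ℕ} :
    hears G B v t = true ↔ B v t = false ∧ ∃ w, G.Adj v w ∧ B w t = true := by
  simp [hears]

theorem hears_eq_false {B : V → ℕ → Bool} {v : V} {t : ℕ} :
    hears G B v t = false ↔ (B v t = false → ∀ w, G.Adj v w → B w t = false) := by
  simp [hears]

@[simp] theorem act_eq_beep {b : Bool} : (act b : Action α) = .beep ↔ b = true := by
  cases b <;> simp [act]

@[simp] theorem act_ne_halt {b : Bool} {a : α} : (act b : Action α) ≠ .halt a := by
  cases b <;> simp [act]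

/-- If the pattern `B` of beeps is consistent with the programs, it is what happens. -/
theorem runHistory_eq_record {P : V → Program α} {B : V → ℕ → Bool} {T : ℕ}
    (h : ∀ t < T, ∀ v, P v (record (hears G B v) t) = act (B v t)) :
    ∀ t ≤ T, ∀ v, runHistory G P t v = record (hears G B v) t := by
  intro t
  induction t with
  | zero => intro _ v; rfl
  | succ t ih =>
    intro ht v
    have ih' := ih (by omega)
    have hP := h t (by omega)
    simp only [runHistory, ih', hP, act_eq_beep, record_succ]
    cases hb : B v t <;> simp [act, hears, hb, ih', hP]

/-- The basic tool of the file: a global run is verified node by node against a predicted pattern.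
-/
theorem haltsAt_of_pattern {P : V → Program α} {B : V → ℕ → Bool} {T : ℕ} {a : V → α}
    (h : ∀ t < T, ∀ v, P v (record (hears G B v) t) = act (B v t))
    (hT : ∀ v, P v (record (hears G B v) T) = .halt (a v)) (v : V) : HaltsAt G P T v (a v) := by
  have := runHistory_eq_record h T le_rfl v
  exact ⟨by rw [HasOutput, this, hT], by rw [this, record_length]⟩

theorem HaltsAt.of_eq {P : V → Program α} {T : ℕ} {v : V} {a b : α} (h : HaltsAt G P T v a)
    (hab : a = b) : HaltsAt G P T v b := hab ▸ h

/-- The length bound is carried through the induction because the hypothesis only covers short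
histories. -/
theorem runHistory_congr {P Q : V → Program α} {T : ℕ}
    (h : ∀ v l, l.length < T → P v l = Q v l) :
    ∀ t ≤ T, ∀ v, runHistory G P t v = runHistory G Q t v ∧ (runHistory G P t v).length ≤ t := by
  intro t
  induction t with
  | zero => intro _ v; simp [runHistory]
  | succ t ih =>
    intro ht v
    have ih' := ih (by omega)
    have hPQ : ∀ w, P w (runHistory G P t w) = Q w (runHistory G P t w) := fun w =>
      h w _ (by have := (ih' w).2; omega)
    have hl := (ih' v).2
    have hfun : runHistory G P t = runHistory G Q t := funext fun w => (ih' w).1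
    simp only [runHistory, hPQ, ← hfun]
    split
    · exact ⟨by simp, by omega⟩
    · exact ⟨by simp, by simp; omega⟩
    · exact ⟨by simp [hPQ, fun w => (ih' w).1.symm], by simp; omega⟩

theorem HaltsAt.congr {P Q : V → Program α} {T : ℕ} {v : V} {a : α}
    (hP : HaltsAt G P T v a) (h : ∀ v l, l.length ≤ T → P v l = Q v l) : HaltsAt G Q T v a := by
  obtain ⟨h1, h2⟩ := runHistory_congr (G := G) (fun v l hl => h v l (le_of_lt hl)) T le_rfl v
  exact ⟨by rw [HasOutput, ← h1, ← h v _ h2]; exact hP.1, by rw [← h1]; exact hP.2⟩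

theorem runHistory_length_le (P : V → Program α) (t : ℕ) (v : V) :
    (runHistory G P t v).length ≤ t :=
  (runHistory_congr (P := P) (Q := P) (T := t) (fun _ _ _ => rfl) t le_rfl v).2

theorem runHistory_of_halt {P : V → Program α} {t : ℕ} {v : V} {a : α}
    (h : P v (runHistory G P t v) = .halt a) (k : ℕ) :
    runHistory G P (t + k) v = runHistory G P t v := by
  induction k with
  | zero => rfl
  | succ k ih =>
    rw [← Nat.add_assoc, runHistory, ih, h]

theorem runHistory_prefix (P : V → Program α) (t k : ℕ) (v : V) :
    runHistory G P t v <+: runHistory G P (t + k) v := by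
  induction k with
  | zero => exact List.prefix_rfl
  | succ k ih =>
    rw [← Nat.add_assoc, runHistory]
    split
    · exact ih
    · exact ih.trans (List.prefix_append _ _)
    · exact ih.trans (List.prefix_append _ _)

/-- A history grows by at most one entry per step, so reaching length `T` at time `T` leaves no step
without growth. -/
theorem HaltsAt.length_eq {P : V → Program α} {T : ℕ} {v : V} {a : α}
    (h : HaltsAt G P T v a) {t : ℕ} (ht : t ≤ T) : (runHistory G P t v).length = t := by
  obtain ⟨k, rfl⟩ := Nat.exists_eq_add_of_le ht
  have hl : ∀ k, (runHistory G P (t + k) v).length ≤ (runHistory G P t v).length + k := by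
    intro k
    induction k with
    | zero => simp
    | succ k ih =>
      rw [← Nat.add_assoc, runHistory]
      split
      · omega
      · simp; omega
      · simp; omega
  have h1 := hl k
  rw [h.2] at h1
  have h2 := runHistory_length_le (G := G) P t v
  omega

theorem HaltsAt.ne_halt {P : V → Program α} {T : ℕ} {v : V} {a : α}
    (h : HaltsAt G P T v a) {t : ℕ} (ht : t < T) (b : α) : P v (runHistory G P t v) ≠ .halt b := by
  intro hb
  have h1 := runHistory_of_halt hb (T - t)
  have h2 := h.length_eq (le_of_lt ht)
  rw [← h1, show t + (T - t) = T by omega, h.2] at h2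
  omega

theorem HaltsAt.take_eq {P : V → Program α} {T : ℕ} {v : V} {a : α}
    (h : HaltsAt G P T v a) {t : ℕ} (ht : t ≤ T) :
    (runHistory G P T v).take t = runHistory G P t v := by
  have h1 := runHistory_prefix (G := G) P t (T - t) v
  rw [show t + (T - t) = T by omega, List.prefix_iff_eq_take, h.length_eq ht] at h1
  exact h1.symm

/-! ### Sequential composition -/

theorem bind_eq_andThen (p : Program α) (f : α → Program β) :
    p >>= f = Program.andThen f p := rfl

theorem andThen_append (f : α → Program β) (p : Program α) (h l : List Bool) {a : α}
    (hn : ∀ k < h.length, ∀ b, p (h.take k) ≠ .halt b) (ha : p h = .halt a) :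
    Program.andThen f p (h ++ l) = f a l := by
  induction h generalizing p with
  | nil =>
    cases l <;> simp [Program.andThen, ha]
  | cons b h ih =>
    have h0 := hn 0 (by simp)
    simp only [List.take_zero] at h0
    rw [List.cons_append, Program.andThen]
    split
    · rename_i a' heq; exact absurd heq (h0 a')
    · apply ih
      · intro k hk c
        have := hn (k + 1) (by simpa using hk) c
        simpa using this
      · exact ha

theorem andThen_of_running (f : α → Program β) (p : Program α) (h : List Bool)
    (hn : ∀ k < h.length, ∀ b, p (h.take k) ≠ .halt b) :
    Program.andThen f p h =
      match p h with
      | .beep => .beep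
      | .listen => .listen
      | .halt a => f a [] := by
  induction h generalizing p with
  | nil => rfl
  | cons b h ih =>
    have h0 := hn 0 (by simp)
    simp only [List.take_zero] at h0
    rw [Program.andThen]
    split
    · rename_i a' heq; exact absurd heq (h0 a')
    · apply ih
      intro k hk c
      have := hn (k + 1) (by simpa using hk) c
      simpa using this

theorem haltsAt_pure (a : V → α) (v : V) : HaltsAt G (fun v => (pure (a v) : Program α)) 0 v (a v) :=
  ⟨rfl, rfl⟩

/-- As all nodes leave the first stage together, the second one runs as if started at time 0: the
joint history is the concatenation of the two histories. -/
theorem HaltsAt.bind {P : V → Program α} {f : V → α → Program β} {T T' : ℕ} {a : V → α} {b : V → β}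
    (h : ∀ v, HaltsAt G P T v (a v)) (h' : ∀ v, HaltsAt G (fun v => f v (a v)) T' v (b v)) (v : V) :
    HaltsAt G (fun v => P v >>= f v) (T + T') v (b v) := by
  have hlen : ∀ t ≤ T, ∀ v, (runHistory G P t v).length = t := fun t ht v => (h v).length_eq ht
  have hrun : ∀ t ≤ T, ∀ v, ∀ k < (runHistory G P t v).length, ∀ b,
      P v ((runHistory G P t v).take k) ≠ .halt b := by
    intro t ht v k hk b
    rw [hlen t ht v] at hk
    rw [← (h v).take_eq ht, List.take_take, min_eq_left hk.le, (h v).take_eq (by omega)]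
    exact (h v).ne_halt (by omega) b
  have h1 : ∀ t ≤ T, ∀ v, runHistory G (fun v => P v >>= f v) t v = runHistory G P t v := by
    intro t
    induction t with
    | zero => intro _ v; rfl
    | succ t ih =>
      intro ht v
      have ih' := ih (by omega)
      have key : ∀ w, (P w >>= f w) (runHistory G P t w) = match P w (runHistory G P t w) with
          | .beep => .beep
          | .listen => .listen
          | .halt a => f w a [] := fun w =>
        andThen_of_running _ _ _ (hrun t (by omega) w)
      have key' : ∀ w, (P w >>= f w) (runHistory G P t w) = .beep ↔
          P w (runHistory G P t w) = .beep := by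
        intro w
        rw [key]
        have := (h w).ne_halt (t := t) (by omega)
        cases hp : P w (runHistory G P t w) <;> simp_all
      simp only [runHistory, ih', key']
      rw [key]
      have := (h v).ne_halt (t := t) (by omega)
      cases hp : P v (runHistory G P t v) <;> simp_all
  have happ : ∀ l v, (P v >>= f v) (runHistory G P T v ++ l) = f v (a v) l := fun l v =>
    andThen_append _ _ _ _ (hrun T le_rfl v) (h v).1
  have h2 : ∀ s, ∀ v, runHistory G (fun v => P v >>= f v) (T + s) v =
      runHistory G P T v ++ runHistory G (fun v => f v (a v)) s v := by
    intro s
    induction s with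
    | zero => intro v; simpa [runHistory] using h1 T le_rfl v
    | succ s ih =>
      intro v
      rw [← Nat.add_assoc]
      simp only [runHistory, ih, happ]
      split <;> simp [ih, happ]
  refine ⟨?_, ?_⟩
  · rw [HasOutput, h2, happ]
    exact (h' v).1
  · rw [h2, List.length_append, (h v).2, (h' v).2]

theorem HaltsAt.bind_pure {P : V → Program α} {T : ℕ} {a : V → α}
    (h : ∀ v, HaltsAt G P T v (a v)) (g : V → α → β) (v : V) :
    HaltsAt G (fun v => P v >>= fun x => pure (g v x)) T v (g v (a v)) :=
  HaltsAt.bind (f := fun v x => pure (g v x)) (T' := 0) h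
    (fun v => haltsAt_pure (fun v => g v (a v)) v) v

/-! ### Programs whose duration does not depend on what they hear -/

/-- `p` terminates after `T` time-steps, whatever it hears. -/
def Timed (p : Program α) (T : ℕ) : Prop := ∀ h, (∃ a, p h = .halt a) ↔ T ≤ h.length

/-- Used for election phases with insufficient budget: outputs may be wrong and differ between
nodes, but the nodes stay synchronous. -/
theorem Timed.haltsAt {P : V → Program α} {T : ℕ} (h : ∀ v, Timed (P v) T) :
    ∃ a : V → α, ∀ v, HaltsAt G P T v (a v) := by
  have hlen : ∀ t ≤ T, ∀ v, (runHistory G P t v).length = t := by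
    intro t
    induction t with
    | zero => intro _ v; rfl
    | succ t ih =>
      intro ht v
      have ih' := ih (by omega) v
      simp only [runHistory]
      split
      · rename_i a heq
        have := (h v _).1 ⟨a, heq⟩
        omega
      · simp [ih']
      · simp [ih']
  choose a ha using fun v => (h v (runHistory G P T v)).2 (hlen T le_rfl v).ge
  exact ⟨a, fun v => ⟨ha v, hlen T le_rfl v⟩⟩

theorem Timed.pure (a : α) : Timed (Pure.pure a : Program α) 0 := fun _ =>
  ⟨fun _ => Nat.zero_le _, fun _ => ⟨a, rfl⟩⟩

theorem Timed.not_halt {p : Program α} {T : ℕ} (hp : Timed p T) {h : List Bool}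
    (hl : h.length < T) (b : α) : p h ≠ .halt b := fun hb => by
  have := (hp h).1 ⟨b, hb⟩
  omega

theorem Timed.bind_append {p : Program α} {T : ℕ} (hp : Timed p T) (f : α → Program β)
    {h : List Bool} (hl : h.length = T) {a : α} (ha : p h = .halt a) (l : List Bool) :
    (p >>= f) (h ++ l) = f a l :=
  andThen_append f p h l (fun k hk b => hp.not_halt (by simp; omega) b) ha

theorem Timed.bind_of_lt {p : Program α} {T : ℕ} (hp : Timed p T) (f : α → Program β)
    {h : List Bool} (hl : h.length < T) :
    (p >>= f) h = match p h with
      | .beep => .beep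
      | .listen => .listen
      | .halt a => f a [] :=
  andThen_of_running f p h (fun k hk b => hp.not_halt (by simp; omega) b)

theorem Timed.bind {p : Program α} {f : α → Program β} {T T' : ℕ} (hp : Timed p T)
    (hf : ∀ a, Timed (f a) T') : Timed (p >>= f) (T + T') := by
  intro h
  by_cases hl : h.length < T
  · rw [hp.bind_of_lt f hl]
    have := hp.not_halt hl
    constructor
    · rintro ⟨a, ha⟩
      cases hq : p h <;> simp_all
    · intro; omega
  · have hT : (h.take T).length = T := by simp; omega
    obtain ⟨a, ha⟩ := (hp (h.take T)).2 hT.ge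
    rw [← List.take_append_drop T h, hp.bind_append f hT ha, hf a]
    simp only [List.length_append, hT]
    omega

theorem Timed.bind_pure {p : Program α} {T : ℕ} (hp : Timed p T) (g : α → β) :
    Timed (p >>= fun x => Pure.pure (g x)) T := hp.bind (T' := 0) fun a => Timed.pure (g a)

end Run

/-! ### Flooding -/

/-- A node with the flag `b` beeps, and so does every node that has heard a beep; after `n`
time-steps the output tells whether there is a flag at distance at most `n`. -/
def flood (b : Bool) (n : ℕ) : Program Bool := fun h =>
  if n ≤ h.length then .halt (b || h.contains true) else act (b || h.contains true)

theorem timed_flood (b : Bool) (n : ℕ) : Timed (flood b n) n := by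
  intro h
  unfold flood
  split <;> simp_all

section Graph

variable {V : Type} {G : SimpleGraph V}

theorem dist_adj_le (hG : G.Connected) {v w : V} (h : G.Adj v w) (u : V) :
    G.dist u v ≤ G.dist u w + 1 := by
  have := hG.dist_triangle (u := u) (v := w) (w := v)
  rwa [SimpleGraph.dist_eq_one_iff_adj.2 h.symm] at this

theorem exists_adj_dist_of_pos (hG : G.Connected) {u v : V} (h : 0 < G.dist u v) :
    ∃ w, G.Adj v w ∧ G.dist u w + 1 = G.dist u v := by
  obtain ⟨p, hp⟩ := hG.exists_walk_length_eq_dist v u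
  cases p with
  | nil => simp at h
  | cons hadj q =>
    rename_i w
    refine ⟨w, hadj, ?_⟩
    have h1 := SimpleGraph.dist_le q
    rw [SimpleGraph.Walk.length_cons, SimpleGraph.dist_comm] at hp
    rw [SimpleGraph.dist_comm] at h1
    have h2 := dist_adj_le hG hadj u
    omega

theorem dist_le_diam_of_finite [Finite V] (hG : G.Connected) (u v : V) :
    G.dist u v ≤ G.diam :=
  haveI := hG.nonempty
  SimpleGraph.dist_le_diam (SimpleGraph.connected_iff_ediam_ne_top.1 hG)

open Classical in
theorem flood_haltsAt (hG : G.Connected) (b : V → Bool) (n : ℕ) (v : V) :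
    HaltsAt G (fun v => flood (b v) n) n v (decide (∃ u, b u = true ∧ G.dist u v ≤ n)) := by
  have key : ∀ t v, (b v || (record (hears G (fun v t =>
      decide (∃ u, b u = true ∧ G.dist u v ≤ t)) v) t).contains true) =
      decide (∃ u, b u = true ∧ G.dist u v ≤ t) := by
    intro t v
    rw [Bool.eq_iff_iff, Bool.or_eq_true, contains_record, decide_eq_true_iff]
    constructor
    · rintro (h | ⟨i, hi, h⟩)
      · exact ⟨v, h, by simp⟩
      · obtain ⟨-, w, hw, h⟩ := hears_eq_true.1 h
        obtain ⟨u, hu, hd⟩ := of_decide_eq_true h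
        exact ⟨u, hu, by have := dist_adj_le hG hw u; omega⟩
    · intro h
      by_cases hv : b v = true
      · exact Or.inl hv
      right
      -- For the least such radius `i`, node `v` still listens in step `i - 1`, while a neighbour
      -- one step closer to the flag already beeps.
      obtain ⟨i, hi, hmin⟩ : ∃ i, (∃ u, b u = true ∧ G.dist u v ≤ i) ∧
          ∀ j < i, ¬∃ u, b u = true ∧ G.dist u v ≤ j :=
        have hex : ∃ i, ∃ u, b u = true ∧ G.dist u v ≤ i := ⟨t, h⟩
        ⟨Nat.find hex, Nat.find_spec hex, fun j hj => Nat.find_min hex hj⟩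
      have hit : i ≤ t := by
        by_contra hlt
        exact hmin t (by omega) h
      obtain ⟨u, hu, hd⟩ := hi
      have hpos : 0 < G.dist u v := by
        apply hG.pos_dist_of_ne
        rintro rfl
        exact hv hu
      obtain ⟨w, hw, hd'⟩ := exists_adj_dist_of_pos hG hpos
      refine ⟨i - 1, by omega, hears_eq_true.2 ⟨?_, w, hw, ?_⟩⟩
      · simpa using hmin (i - 1) (by omega)
      · exact decide_eq_true ⟨u, hu, by omega⟩
  refine haltsAt_of_pattern (B := fun v t => decide (∃ u, b u = true ∧ G.dist u v ≤ t))
    (a := fun v => decide (∃ u, b u = true ∧ G.dist u v ≤ n)) ?_ ?_ v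
  · intro t ht v
    rw [flood, record_length, if_neg (by omega), key]
  · intro v
    rw [flood, record_length, if_pos le_rfl, key]

end Graph

/-! ### Leader election -/

/-- The largest `k` with `2 ^ k ≤ s` for the size `s` of an ID, as far as it can be found out
if the class `k` is flooded for `2 ^ (p - k)` time-steps. -/
def sizeClass (p s : ℕ) : ℕ → Program ℕ
  | 0 => pure 0
  | k + 1 => do
    let b ← flood (decide (2 ^ (k + 1) ≤ s)) (2 ^ (p - (k + 1)))
    let r ← sizeClass p s k
    pure (if b then k + 1 else r)

/-- Bitwise determination of the highest ID; `acc` consists of the bits known so far. -/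
def campaign (id len : ℕ) : ℕ → ℕ → Program ℕ
  | 0, acc => pure acc
  | i + 1, acc => do
    let b ← flood (decide (id / 2 ^ i = 2 * acc + 1)) len
    campaign id len i (2 * acc + b.toNat)

/-- Do all neighbours have the same lowest `i` bits of `x`? -/
def agree (x : ℕ) : ℕ → Program Bool
  | 0 => pure true
  | i + 1 => do
    let a ← flood (x.testBit i) 1
    let b ← flood (!x.testBit i) 1
    let r ← agree x i
    pure (r && !(a && b))

/-- Is `x` the highest ID? If the answer is yes anywhere, then it is correct and the same
everywhere. -/
def verifyLeader (p id x : ℕ) : Program Bool := do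
  let a ← agree x (2 ^ (p + 1))
  let r ← flood (decide (x = id)) (2 ^ p)
  let bad ← flood (!(a && r && decide (id ≤ x) && decide (x < 2 ^ 2 ^ (p + 1)))) (2 ^ (p + 2))
  pure !bad

/-- An attempt at leader election that takes time `O(2 ^ p)`. -/
def electPhase (p id : ℕ) : Program (Option ℕ) := do
  let k ← sizeClass p id.size p
  let x ← campaign id (2 ^ (p - min k p)) (2 ^ (min k p + 1)) 0
  let ok ← verifyLeader p id x
  pure (if ok then some x else none)

/-- At most `n` attempts at leader election, starting with phase `p`. -/
def electPhases (id : ℕ) : ℕ → ℕ → Program ℕ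
  | 0, _ => fun _ => .listen
  | n + 1, p => do
    let r ← electPhase p id
    match r with
    | some x => pure x
    | none => electPhases id n (p + 1)

/-- Leader election: attempts with growing running time until one succeeds. -/
def elect (id : ℕ) : Program ℕ := fun h => electPhases id (h.length + 1) 0 h

/-- The duration of `sizeClass`. -/
def sizeClassTime (p : ℕ) : ℕ → ℕ
  | 0 => 0
  | k + 1 => 2 ^ (p - (k + 1)) + sizeClassTime p k

theorem timed_sizeClass (p s k : ℕ) : Timed (sizeClass p s k) (sizeClassTime p k) := by
  induction k with
  | zero => exact Timed.pure 0
  | succ k ih => exact (timed_flood _ _).bind fun b => ih.bind_pure _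

theorem timed_campaign (id len i acc : ℕ) : Timed (campaign id len i acc) (i * len) := by
  induction i generalizing acc with
  | zero => rw [Nat.zero_mul]; exact Timed.pure acc
  | succ i ih =>
    rw [Nat.succ_mul, Nat.add_comm (i * len)]
    exact (timed_flood _ _).bind fun b => ih _

theorem timed_agree (x i : ℕ) : Timed (agree x i) (2 * i) := by
  induction i with
  | zero => exact Timed.pure true
  | succ i ih =>
    rw [show 2 * (i + 1) = 1 + (1 + 2 * i) by omega]
    exact (timed_flood _ _).bind fun a => (timed_flood _ _).bind fun b => ih.bind_pure _

theorem timed_verifyLeader (p id x : ℕ) :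
    Timed (verifyLeader p id x) (2 * 2 ^ (p + 1) + (2 ^ p + 2 ^ (p + 2))) :=
  (timed_agree _ _).bind fun _ => (timed_flood _ _).bind fun _ => (timed_flood _ _).bind_pure _

/-- The duration of a phase. -/
def phaseTime (p : ℕ) : ℕ :=
  sizeClassTime p p + (2 ^ (p + 1) + (2 * 2 ^ (p + 1) + (2 ^ p + 2 ^ (p + 2))))

theorem timed_electPhase (p id : ℕ) : Timed (electPhase p id) (phaseTime p) := by
  refine (timed_sizeClass _ _ _).bind fun k => Timed.bind ?_ fun x =>
    (timed_verifyLeader _ _ _).bind_pure _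
  have := timed_campaign id (2 ^ (p - min k p)) (2 ^ (min k p + 1)) 0
  rwa [← pow_add, show min k p + 1 + (p - min k p) = p + 1 by omega] at this

theorem phaseTime_pos (p : ℕ) : 0 < phaseTime p := by unfold phaseTime; positivity

theorem sizeClassTime_le (p k : ℕ) (h : k ≤ p) : sizeClassTime p k + 2 ^ (p - k) ≤ 2 ^ p := by
  induction k with
  | zero => simp [sizeClassTime]
  | succ k ih =>
    have := ih (by omega)
    rw [show p - k = p - (k + 1) + 1 by omega, pow_succ] at this
    simp only [sizeClassTime]
    omega

theorem phaseTime_le (p : ℕ) : phaseTime p ≤ 12 * 2 ^ p := by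
  have := sizeClassTime_le p p le_rfl
  rw [Nat.sub_self] at this
  simp only [phaseTime, pow_succ]
  omega

/-! ### Correctness and running time of the leader election. -/

section Election

variable {V : Type} {G : SimpleGraph V}

/-- Larger classes take precedence. Above `K` no flag exists, so the flood length is irrelevant; at
`K` the flood covers the diameter; below `K` answers may be wrong but are overridden. -/
theorem sizeClass_haltsAt [Finite V] (hG : G.Connected) (s : V → ℕ) {p K : ℕ}
    (hK : 0 < K → ∃ v, 2 ^ K ≤ s v) (hs : ∀ v, s v < 2 ^ (K + 1)) (hp : G.diam ≤ 2 ^ (p - K)) :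
    ∀ k, ∃ r : V → ℕ, (K ≤ k → ∀ v, r v = K) ∧
      ∀ v, HaltsAt G (fun v => sizeClass p (s v) k) (sizeClassTime p k) v (r v) := by
  intro k
  induction k with
  | zero => exact ⟨fun _ => 0, fun h v => (Nat.le_zero.1 h).symm, haltsAt_pure (fun _ => 0)⟩
  | succ k ih =>
    obtain ⟨r, hr, hr'⟩ := ih
    refine ⟨_, ?_, HaltsAt.bind (flood_haltsAt hG (fun v => decide (2 ^ (k + 1) ≤ s v)) _)
      (HaltsAt.bind_pure hr' fun v r => _)⟩
    intro hk v
    rcases Nat.lt_or_ge K (k + 1) with h | h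
    · rw [if_neg, hr (by omega)]
      simp only [decide_eq_true_eq, not_exists, not_and]
      intro u hu
      have h1 := hs u
      have h2 : 2 ^ (K + 1) ≤ 2 ^ (k + 1) := Nat.pow_le_pow_right (by norm_num) (by omega)
      omega
    · obtain rfl : K = k + 1 := by omega
      obtain ⟨u, hu⟩ := hK (by omega)
      rw [if_pos]
      simp only [decide_eq_true_eq]
      exact ⟨u, hu, (dist_le_diam_of_finite hG _ _).trans hp⟩

/-- Truncation of IDs is monotone: a flag extending the prefix of the maximum by 1 forces the next
bit of the maximum to be 1, and if that bit is 1, then `l` itself raises the flag. -/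
theorem campaign_haltsAt [Finite V] (hG : G.Connected) {ID : V → ℕ} {l : V}
    (hl : ∀ v, ID v ≤ ID l) {len : ℕ} (hlen : G.diam ≤ len) (i : ℕ) :
    ∀ v, HaltsAt G (fun v => campaign (ID v) len i (ID l / 2 ^ i)) (i * len) v (ID l) := by
  induction i with
  | zero => simpa [campaign] using haltsAt_pure (G := G) (fun _ => ID l)
  | succ i ih =>
    rw [Nat.succ_mul, Nat.add_comm (i * len)]
    refine HaltsAt.bind (flood_haltsAt hG
      (fun v => decide (ID v / 2 ^ i = 2 * (ID l / 2 ^ (i + 1)) + 1)) len) fun v => ?_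
    convert ih v using 3
    rename_i w
    rw [pow_succ, ← Nat.div_div_eq_div_mul]
    have h2 := Nat.div_add_mod (ID l / 2 ^ i) 2
    have h3 := Nat.mod_lt (ID l / 2 ^ i) (show 2 > 0 by norm_num)
    by_cases h : ∃ u, decide (ID u / 2 ^ i = 2 * (ID l / 2 ^ i / 2) + 1) = true ∧ G.dist u w ≤ len
    · simp only [h, decide_true, Bool.toNat_true]
      obtain ⟨u, hu, -⟩ := h
      have h1 := Nat.div_le_div_right (c := 2 ^ i) (hl u)
      rw [of_decide_eq_true hu] at h1
      omega
    · simp only [h, decide_false, Bool.toNat_false]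
      push Not at h
      by_contra hne
      have := h l (decide_eq_true (by omega))
      have := dist_le_diam_of_finite hG l w
      omega

open Classical in
-- A node hearing a beep tells nothing about its silent neighbours, so each bit is flooded together
-- with its negation; disagreement in the closed neighbourhood means that both flags are seen.
theorem agree_haltsAt (hG : G.Connected) (x : V → ℕ) (i : ℕ) :
    ∀ v, HaltsAt G (fun v => agree (x v) i) (2 * i) v
      (decide (∀ j < i, ∀ w, G.Adj v w → (x v).testBit j = (x w).testBit j)) := by
  induction i with
  | zero => simpa [agree] using haltsAt_pure (G := G) (fun _ => true)
  | succ i ih =>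
    intro v
    rw [show 2 * (i + 1) = 1 + (1 + 2 * i) by omega]
    refine HaltsAt.of_eq (HaltsAt.bind (flood_haltsAt hG (fun v => (x v).testBit i) 1)
      (fun v => HaltsAt.bind (flood_haltsAt hG (fun v => !(x v).testBit i) 1)
        (fun v => HaltsAt.bind_pure ih _ v) v) v) ?_
    have hd : ∀ u, G.dist u v ≤ 1 ↔ u = v ∨ G.Adj v u := by
      intro u
      rw [Nat.le_one_iff_eq_zero_or_eq_one, hG.dist_eq_zero_iff, SimpleGraph.dist_eq_one_iff_adj,
        G.adj_comm]
    symm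
    rw [Bool.eq_iff_iff, decide_eq_true_iff, Bool.and_eq_true, decide_eq_true_iff]
    simp only [hd, Nat.lt_succ_iff_lt_or_eq, Bool.not_eq_true', Bool.and_eq_false_iff,
      decide_eq_false_iff_not]
    constructor
    · intro h
      refine ⟨fun j hj => h j (Or.inl hj), ?_⟩
      have hi := h i (Or.inr rfl)
      by_contra hc
      push Not at hc
      obtain ⟨⟨u, hu, hu'⟩, w, hw, hw'⟩ := hc
      have h1 : (x v).testBit i = true := by
        rcases hu' with rfl | hu'
        · exact hu
        · rw [hi u hu', hu]
      have h2 : (x v).testBit i = false := by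
        rcases hw' with rfl | hw'
        · exact hw
        · rw [hi w hw', hw]
      simp [h1] at h2
    · rintro ⟨h1, h2⟩ j hj w hw
      rcases hj with hj | rfl
      · exact h1 j hj w hw
      · by_contra hne
        rcases h2 with h2 | h2
        · apply h2
          cases hv : (x v).testBit j
          · exact ⟨w, by rw [hv] at hne; simpa using Ne.symm hne, Or.inr hw⟩
          · exact ⟨v, hv, Or.inl rfl⟩
        · apply h2
          cases hv : (x v).testBit j
          · exact ⟨v, hv, Or.inl rfl⟩
          · exact ⟨w, by rw [hv] at hne; simpa using Ne.symm hne, Or.inr hw⟩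

/-- The local test of the claim that `x u` is the highest ID. -/
def PlausibleLeader (G : SimpleGraph V) (ID x : V → ℕ) (p : ℕ) (u : V) : Prop :=
  (∀ j < 2 ^ (p + 1), ∀ w, G.Adj u w → (x u).testBit j = (x w).testBit j) ∧
    (∃ w, x w = ID w ∧ G.dist w u ≤ 2 ^ p) ∧ ID u ≤ x u ∧ x u < 2 ^ 2 ^ (p + 1)

open Classical in
theorem verifyLeader_haltsAt (hG : G.Connected) (ID x : V → ℕ) (p : ℕ) (v : V) :
    HaltsAt G (fun v => verifyLeader p (ID v) (x v)) (2 * 2 ^ (p + 1) + (2 ^ p + 2 ^ (p + 2))) v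
      (decide (∀ u, G.dist u v ≤ 2 ^ (p + 2) → PlausibleLeader G ID x p u)) := by
  refine HaltsAt.of_eq (HaltsAt.bind (agree_haltsAt hG x (2 ^ (p + 1)))
    (fun v => HaltsAt.bind (flood_haltsAt hG (fun v => decide (x v = ID v)) (2 ^ p))
      (fun v => HaltsAt.bind_pure (flood_haltsAt hG _ (2 ^ (p + 2))) _ v) v) v) ?_
  symm
  rw [Bool.eq_iff_iff, decide_eq_true_iff]
  simp only [Bool.not_eq_true', decide_eq_false_iff_not, Bool.and_eq_false_iff,
    PlausibleLeader, decide_eq_true_eq]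
  rw [not_exists]
  refine forall_congr' fun u => ?_
  simp only [← not_and_or]
  rw [not_and', not_not]
  simp only [and_assoc]

/-- With `R = 2 ^ p`, neighbour agreement makes `x` constant on the ball of radius `4 R` about `v`.
Every node within `3 R` has the owner of this common value within `R`; the owner is unique and lies
within `R` of `v`. Hence the shell between `2 R` and `3 R` is empty, and by connectedness the ball
of radius `2 R` is the whole network. -/
theorem eq_of_plausibleLeader (hG : G.Connected) {ID x : V → ℕ} (hID : Function.Injective ID)
    {p : ℕ} {v : V} (h : ∀ u, G.dist u v ≤ 2 ^ (p + 2) → PlausibleLeader G ID x p u) :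
    ∀ u, PlausibleLeader G ID x p u ∧ x u = x v := by
  have hR : 0 < 2 ^ p := by positivity
  rw [show 2 ^ (p + 2) = 4 * 2 ^ p by ring] at h
  have h1 : ∀ n u, G.dist v u = n → n ≤ 4 * 2 ^ p → x u = x v := by
    intro n
    induction n with
    | zero =>
      intro u hu _
      rw [hG.dist_eq_zero_iff.1 hu]
    | succ n ih =>
      intro u hu hn
      obtain ⟨w, hw, hd⟩ := exists_adj_dist_of_pos hG (u := v) (v := u) (by omega)
      rw [← ih w (by omega) (by omega)]
      have hu' := h u (by rw [SimpleGraph.dist_comm]; omega)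
      have hw' := h w (by rw [SimpleGraph.dist_comm]; omega)
      apply Nat.eq_of_testBit_eq
      intro j
      rcases Nat.lt_or_ge j (2 ^ (p + 1)) with hj | hj
      · exact hu'.1 j hj w hw
      · rw [Nat.testBit_lt_two_pow (hu'.2.2.2.trans_le (Nat.pow_le_pow_right (by norm_num) hj)),
          Nat.testBit_lt_two_pow (hw'.2.2.2.trans_le (Nat.pow_le_pow_right (by norm_num) hj))]
  obtain ⟨w₀, hw₀, hd₀⟩ := (h v (by simp)).2.1
  have hx₀ : x w₀ = x v := h1 _ w₀ rfl (by rw [SimpleGraph.dist_comm]; omega)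
  -- The owner near `u` is within `3 R + R` of `v`, still inside the ball where `x` is constant, so
  -- it equals `w₀`.
  have h2 : ∀ u, G.dist v u ≤ 3 * 2 ^ p → G.dist v u ≤ 2 * 2 ^ p := by
    intro u hu
    obtain ⟨w, hw, hd⟩ := (h u (by rw [SimpleGraph.dist_comm]; omega)).2.1
    have t1 := hG.dist_triangle (u := v) (v := u) (w := w)
    rw [SimpleGraph.dist_comm (u := u)] at t1
    have hxw : x w = x v := h1 _ w rfl (by omega)
    obtain rfl : w = w₀ := hID (by rw [← hw, ← hw₀, hxw, hx₀])
    have t2 := hG.dist_triangle (u := v) (v := w) (w := u)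
    rw [SimpleGraph.dist_comm (u := v) (v := w)] at t2
    omega
  have h3 : ∀ n u, G.dist v u = n → n ≤ 2 * 2 ^ p := by
    intro n
    induction n with
    | zero => intros; omega
    | succ n ih =>
      intro u hu
      obtain ⟨w, hw, hd⟩ := exists_adj_dist_of_pos hG (u := v) (v := u) (by omega)
      have := ih w (by omega)
      have := h2 u (by omega)
      omega
  intro u
  have := h3 _ u rfl
  exact ⟨h u (by rw [SimpleGraph.dist_comm]; omega), h1 _ u rfl (by omega)⟩

/-- A phase never elects a wrong node and never splits the network, whatever its guesses; it is
certain to succeed once the floods cover the diameter. -/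
theorem electPhase_haltsAt [Finite V] (hG : G.Connected) {ID : V → ℕ}
    (hID : Function.Injective ID) {l : V} (hl : ∀ v, ID v ≤ ID l) (p : ℕ) :
    ∃ r : Option ℕ, (∀ v, HaltsAt G (fun v => electPhase p (ID v)) (phaseTime p) v r) ∧
      (r = none ∨ r = some (ID l)) ∧
      (Nat.log 2 (ID l).size ≤ p → G.diam ≤ 2 ^ (p - Nat.log 2 (ID l).size) →
        r = some (ID l)) := by
  classical
  set K := Nat.log 2 (ID l).size with hK
  have hsz : (ID l).size < 2 ^ (K + 1) := Nat.lt_pow_succ_log_self (by norm_num) _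
  obtain ⟨k, hk, hk'⟩ : ∃ k : V → ℕ, (K ≤ p → G.diam ≤ 2 ^ (p - K) → ∀ v, k v = K) ∧
      ∀ v, HaltsAt G (fun v => sizeClass p (ID v).size p) (sizeClassTime p p) v (k v) := by
    by_cases hd : G.diam ≤ 2 ^ (p - K)
    · obtain ⟨k, hk, hk'⟩ := sizeClass_haltsAt hG (fun v => (ID v).size) (p := p) (K := K)
        (fun hK' => ⟨l, Nat.pow_log_le_self 2 (fun h0 => by simp [hK, h0] at hK')⟩)
        (fun v => (Nat.size_le_size (hl v)).trans_lt hsz) hd p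
      exact ⟨k, fun h _ => hk h, hk'⟩
    · obtain ⟨k, hk⟩ := Timed.haltsAt (G := G) fun v => timed_sizeClass p (ID v).size p
      exact ⟨k, fun _ h => absurd h hd, hk⟩
  obtain ⟨x, hx, hx'⟩ : ∃ x : V → ℕ, (K ≤ p → G.diam ≤ 2 ^ (p - K) → ∀ v, x v = ID l) ∧
      ∀ v, HaltsAt G (fun v => campaign (ID v) (2 ^ (p - min (k v) p)) (2 ^ (min (k v) p + 1)) 0)
        (2 ^ (p + 1)) v (x v) := by
    by_cases hd : K ≤ p ∧ G.diam ≤ 2 ^ (p - K)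
    · refine ⟨fun _ => ID l, fun _ _ _ => rfl, ?_⟩
      simp only [hk hd.1 hd.2, min_eq_left hd.1]
      have := campaign_haltsAt hG hl hd.2 (2 ^ (K + 1))
      rw [Nat.div_eq_of_lt, ← pow_add, show K + 1 + (p - K) = p + 1 by omega] at this
      · exact this
      · exact (Nat.lt_size_self _).trans_le (Nat.pow_le_pow_right (by norm_num) hsz.le)
    · obtain ⟨x, hx⟩ := Timed.haltsAt (G := G) (T := 2 ^ (p + 1)) fun v => by
        have := timed_campaign (ID v) (2 ^ (p - min (k v) p)) (2 ^ (min (k v) p + 1)) 0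
        rwa [← pow_add, show min (k v) p + 1 + (p - min (k v) p) = p + 1 by omega] at this
      exact ⟨x, fun h h' => absurd ⟨h, h'⟩ hd, hx⟩
  have hrun : ∀ v, HaltsAt G (fun v => electPhase p (ID v)) (phaseTime p) v
      (if decide (∀ u, G.dist u v ≤ 2 ^ (p + 2) → PlausibleLeader G ID x p u) = true
        then some (x v) else none) :=
    HaltsAt.bind hk' fun v => HaltsAt.bind
      (f := fun v x => verifyLeader p (ID v) x >>= fun ok => pure (if ok then some x else none))
      (b := fun v => if decide (∀ u, G.dist u v ≤ 2 ^ (p + 2) → PlausibleLeader G ID x p u) = true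
        then some (x v) else none) hx' (fun v => HaltsAt.bind_pure
      (verifyLeader_haltsAt hG ID x p) (fun v ok => if ok then some (x v) else none) v) v
  by_cases hok : ∃ v, ∀ u, G.dist u v ≤ 2 ^ (p + 2) → PlausibleLeader G ID x p u
  · obtain ⟨v₀, hv₀⟩ := hok
    have hall := eq_of_plausibleLeader hG hID hv₀
    have hxl : ∀ v, x v = ID l := by
      obtain ⟨w, hw, -⟩ := (hall v₀).1.2.1
      intro v
      have h1 := (hall l).1.2.2.1
      rw [(hall l).2, ← (hall w).2, hw] at h1
      rw [(hall v).2, ← (hall w).2, hw]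
      exact le_antisymm (hl w) h1
    refine ⟨some (ID l), fun v => ?_, Or.inr rfl, fun _ _ => rfl⟩
    convert hrun v using 1
    rw [if_pos (decide_eq_true fun u _ => (hall u).1), hxl]
  · refine ⟨none, fun v => ?_, Or.inl rfl, fun h h' => ?_⟩
    · convert hrun v using 1
      rw [if_neg]
      push Not at hok
      simpa using hok v
    · exfalso
      apply hok
      have hxl := hx h h'
      refine ⟨l, fun u _ => ⟨fun j _ w _ => by rw [hxl, hxl], ⟨l, hxl l, ?_⟩, ?_, ?_⟩⟩
      · exact (dist_le_diam_of_finite hG _ _).trans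
          (h'.trans (Nat.pow_le_pow_right (by norm_num) (Nat.sub_le _ _)))
      · rw [hxl]; exact hl u
      · rw [hxl]
        exact (Nat.lt_size_self _).trans_le (Nat.pow_le_pow_right (by norm_num)
          (hsz.le.trans (Nat.pow_le_pow_right (by norm_num) (by omega))))

/-- The term `12 * 2 ^ p` on the left makes the geometric sum of the phase costs telescope. Success
before phase `P` is harmless. -/
theorem electPhases_haltsAt [Finite V] (hG : G.Connected) {ID : V → ℕ}
    (hID : Function.Injective ID) {l : V} (hl : ∀ v, ID v ≤ ID l) {P : ℕ}
    (hP : Nat.log 2 (ID l).size ≤ P) (hd : G.diam ≤ 2 ^ (P - Nat.log 2 (ID l).size)) (d : ℕ) :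
    ∀ p, p + d = P → ∃ T, T + 12 * 2 ^ p ≤ 12 * 2 ^ (P + 1) ∧
      ∀ n, d < n → ∀ v, HaltsAt G (fun v => electPhases (ID v) n p) T v (ID l) := by
  induction d with
  | zero =>
    intro p hp
    obtain rfl : p = P := by omega
    obtain ⟨r, hr, -, hr'⟩ := electPhase_haltsAt hG hID hl p
    obtain rfl := hr' hP hd
    refine ⟨phaseTime p, ?_, fun n hn v => ?_⟩
    · have := phaseTime_le p
      rw [pow_succ]
      omega
    · obtain ⟨n, rfl⟩ : ∃ n', n = n' + 1 := ⟨n - 1, by omega⟩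
      refine HaltsAt.bind (T' := 0) (b := fun _ => ID l) hr (fun v => ?_) v
      exact haltsAt_pure (fun _ => ID l) v
  | succ d ih =>
    intro p hp
    have hle := phaseTime_le p
    obtain ⟨r, hr, hr', -⟩ := electPhase_haltsAt hG hID hl p
    obtain ⟨T, hT, hT'⟩ := ih (p + 1) (by omega)
    have hpow : 2 ^ (p + 1) = 2 * 2 ^ p := by ring
    rcases hr' with rfl | rfl
    · refine ⟨phaseTime p + T, by omega, fun n hn v => ?_⟩
      obtain ⟨n, rfl⟩ : ∃ n', n = n' + 1 := ⟨n - 1, by omega⟩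
      refine HaltsAt.bind (b := fun _ => ID l) hr (fun v => ?_) v
      exact hT' n (by omega) v
    · refine ⟨phaseTime p, by omega, fun n hn v => ?_⟩
      obtain ⟨n, rfl⟩ : ∃ n', n = n' + 1 := ⟨n - 1, by omega⟩
      refine HaltsAt.bind (T' := 0) (b := fun _ => ID l) hr (fun v => ?_) v
      exact haltsAt_pure (fun _ => ID l) v

/-- Each phase lasts at least one step, so a history shorter than the number of permitted attempts
never exhausts them. -/
theorem electPhases_fuel (id : ℕ) (n : ℕ) : ∀ m p h, h.length < n → h.length < m →
    electPhases id n p h = electPhases id m p h := by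
  induction n with
  | zero => intros; omega
  | succ n ih =>
    intro m p h hn hm
    obtain ⟨m, rfl⟩ : ∃ m', m = m' + 1 := ⟨m - 1, by omega⟩
    have ht := timed_electPhase p id
    by_cases hl : h.length < phaseTime p
    · rw [electPhases, electPhases, ht.bind_of_lt _ hl, ht.bind_of_lt _ hl]
      have := ht.not_halt hl
      cases hq : electPhase p id h <;> simp_all
    · have hT : (h.take (phaseTime p)).length = phaseTime p := by simp; omega
      obtain ⟨a, ha⟩ := (ht (h.take (phaseTime p))).2 hT.ge
      have hpos := phaseTime_pos p
      rw [electPhases, electPhases, ← List.take_append_drop (phaseTime p) h,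
        ht.bind_append _ hT ha, ht.bind_append _ hT ha]
      cases a with
      | some x => rfl
      | none => exact ih m (p + 1) _ (by simp; omega) (by simp; omega)

theorem size_le_logb {x L : ℕ} (h : x < L) : (x.size : ℝ) ≤ Real.logb 2 L + 1 := by
  rcases Nat.eq_zero_or_pos x.size with h0 | h0
  · rw [h0, Nat.cast_zero]
    have : 0 ≤ Real.logb 2 L := Real.logb_nonneg (by norm_num) (by exact_mod_cast Nat.one_le_of_lt h)
    linarith
  · have h1 : 2 ^ (x.size - 1) ≤ x := Nat.lt_size.1 (by omega)
    have h2 : ((x.size - 1 : ℕ) : ℝ) ≤ Real.logb 2 L := by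
      rw [Real.le_logb_iff_rpow_le (by norm_num) (by exact_mod_cast (Nat.zero_le x).trans_lt h),
        Real.rpow_natCast]
      exact_mod_cast h1.trans h.le
    rw [Nat.cast_sub h0] at h2
    push_cast at h2
    linarith

theorem isLeaderElection_elect : IsLeaderElection elect := by
  refine ⟨48, fun V _ G ID L hG hID hL => ?_⟩
  have := hG.nonempty
  obtain ⟨l, hl⟩ := Finite.exists_max ID
  set K := Nat.log 2 (ID l).size with hK
  -- The first phase certain to succeed is `P = K + e`; `2 ^ e ≤ 2 (D + 1)` and `2 ^ K ≤ log L + 1`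
  -- turn `12 * 2 ^ (P + 1)` into the constant 48.
  set e := Nat.log 2 G.diam + 1 with he
  have hd : G.diam ≤ 2 ^ e := (Nat.lt_pow_succ_log_self (by norm_num) _).le
  have he' : 2 ^ e ≤ 2 * (G.diam + 1) := by
    rw [he, pow_succ, mul_comm]
    refine Nat.mul_le_mul_left 2 ?_
    rcases Nat.eq_zero_or_pos G.diam with h | h
    · simp [h]
    · exact (Nat.pow_log_le_self 2 h.ne').trans (Nat.le_succ _)
  have hK' : ((2 ^ K : ℕ) : ℝ) ≤ Real.logb 2 L + 1 := by
    rcases Nat.eq_zero_or_pos (ID l).size with h | h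
    · have : 0 ≤ Real.logb 2 L :=
        Real.logb_nonneg (by norm_num) (by exact_mod_cast Nat.one_le_of_lt (hL l))
      rw [hK, h]
      simpa using this
    · refine le_trans ?_ (size_le_logb (hL l))
      exact_mod_cast Nat.pow_log_le_self 2 h.ne'
  obtain ⟨T, hT, hrun⟩ := electPhases_haltsAt hG hID hl (P := K + e) (by omega)
    (by rwa [Nat.add_sub_cancel_left]) (K + e) 0 (by omega)
  refine ⟨T, l, hl, ?_, fun v => ?_⟩
  · have h1 : T ≤ 48 * ((G.diam + 1) * 2 ^ K) := by
      have : 12 * 2 ^ (K + e + 1) = 24 * 2 ^ K * 2 ^ e := by ring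
      have h2 := Nat.mul_le_mul_left (24 * 2 ^ K) he'
      nlinarith
    calc (T : ℝ) ≤ 48 * (((G.diam : ℝ) + 1) * ((2 ^ K : ℕ) : ℝ)) := by exact_mod_cast h1
      _ ≤ _ := by gcongr
  · have hbig := hrun (K + e + T + 1) (by omega) v
    refine hbig.congr fun w h hh => ?_
    exact electPhases_fuel _ _ _ _ _ (by omega) (by omega)

end Election

/-! ### Coding -/

theorem decodeBody_encoded (m l : List Bool) :
    decodeBody (m.flatMap (fun b => [b, b]) ++ (true :: false :: l)) = some m := by
  induction m with
  | nil => simp [decodeBody]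
  | cons b m ih => cases b <;> simp [decodeBody, ih]

/-- Inside the doubled bits every aligned pair has equal entries, so the terminator `10` cannot be
read too early. -/
theorem decodeBody_take (m : List Bool) (k : ℕ)
    (hk : k < (m.flatMap (fun b => [b, b]) ++ [true, false]).length) :
    decodeBody ((m.flatMap (fun b => [b, b]) ++ [true, false]).take k) = none := by
  induction m generalizing k with
  | nil =>
    simp only [List.flatMap_nil, List.nil_append, List.length_cons, List.length_nil] at hk
    interval_cases k <;> simp [decodeBody]
  | cons b m ih =>
    match k with
    | 0 => simp [decodeBody]
    | 1 => cases b <;> simp [decodeBody]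
    | k + 2 =>
      have := ih k (by simp at hk ⊢; omega)
      cases b <;> simp [decodeBody, this]

theorem decode_encode_append (m l : List Bool) : decode (encode m ++ l) = some m := by
  simpa [encode, decode] using decodeBody_encoded m l

theorem decode_take_encode (m : List Bool) (k : ℕ) (hk : k < (encode m).length) :
    decode ((encode m).take k) = none := by
  match k with
  | 0 => simp [decode]
  | 1 => simp [encode, decode]
  | k + 2 =>
    have := decodeBody_take m k (by simp [encode] at hk ⊢; omega)
    simpa [encode, decode] using this

theorem encode_length (m : List Bool) : (encode m).length = 2 * m.length + 4 := by
  simp [encode]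
  omega

theorem encode_getD_zero (m : List Bool) : (encode m).getD 0 false = true := by
  simp [encode]

theorem everyThird_record (n : ℕ) : ∀ f : ℕ → Bool,
    everyThird (record f n) = record (fun i => f (3 * i)) ((n + 2) / 3) := by
  induction n using Nat.strong_induction_on with
  | _ n ih =>
    intro f
    match n with
    | 0 => simp [record, everyThird]
    | 1 => simp [record, everyThird]
    | 2 => simp [record, everyThird, List.range_succ]
    | n + 3 =>
      rw [show n + 3 = 1 + (1 + (1 + n)) by omega, record_add, record_add, record_add,
        show (1 + (1 + (1 + n)) + 2) / 3 = 1 + (n + 2) / 3 by omega, record_add]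
      simp only [record, List.range_one, List.map_cons, List.map_nil, List.cons_append,
        List.nil_append, everyThird]
      have := ih n (by omega) (fun i => f (1 + (1 + (1 + i))))
      simp only [record] at this
      rw [this]
      simp only [List.cons.injEq, true_and]
      apply List.map_congr_left
      intro i _
      congr 1
      ring

theorem record_getD (x : List Bool) (n : ℕ) :
    record (fun i => x.getD i false) n =
      x.take n ++ List.replicate (n - x.length) false := by
  apply List.ext_getElem
  · simp; omega
  · intro i h1 h2
    simp only [record_length] at h1
    rcases Nat.lt_or_ge i x.length with h | h
    · simp [record, h1, h]
    · simp [record, h]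

/-! ### Beep waves -/

/-- Does a node beep in time-step `t` that relays a wave with the code `x` and beeps for the first
time in time-step `j`? -/
def waveBeep (x : List Bool) (j t : ℕ) : Bool :=
  decide (j ≤ t) && decide ((t - j) % 3 = 0) && x.getD ((t - j) / 3) false

theorem waveBeep_eq_true {x : List Bool} {j t : ℕ} :
    waveBeep x j t = true ↔ j ≤ t ∧ (t - j) % 3 = 0 ∧ x.getD ((t - j) / 3) false = true := by
  simp [waveBeep, and_assoc]

theorem waveBeep_of_lt {x : List Bool} {j t : ℕ} (h : t < j) : waveBeep x j t = false := by
  simp [waveBeep]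
  omega

theorem waveBeep_add (x : List Bool) (s j t : ℕ) :
    waveBeep x (s + j) (s + t) = waveBeep x j t := by
  simp only [waveBeep, Nat.add_sub_add_left, Nat.add_le_add_iff_left]

/-- What a node hears that is reached by the wave in time-step `a`; `c` tells whether it has
neighbours farther away from the source. -/
def waveHeard (x : List Bool) (c : Bool) (a t : ℕ) : Bool :=
  waveBeep x a t || (c && waveBeep x (a + 2) t)

theorem relayRev_record (f : ℕ → Bool) (n : ℕ) :
    relayRev (record f (n + 2)).reverse = (f (n + 1) && !relayRev (record f n).reverse) := by
  simp [record_succ, relayRev]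

/-- Beeps of nearer nodes come one step before the node's own slot and are relayed. Echoes from
farther nodes come one step after it, each following an own beep, and are suppressed. -/
theorem relayRev_waveHeard (x : List Bool) (c : Bool) (a n : ℕ) :
    relayRev (record (waveHeard x c a) n).reverse = waveBeep x (a + 1) n := by
  induction n using Nat.twoStepInduction with
  | zero => simp [record, relayRev, waveBeep]
  | one =>
    have h1 : waveBeep x (a + 2) 0 = false := waveBeep_of_lt (by omega)
    have h2 := waveBeep_add x 1 a 0
    rw [Nat.add_comm, Nat.add_zero] at h2
    simp [record, relayRev, waveHeard, h1, h2]
  | more n ih _ =>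
    rw [relayRev_record, ih, waveHeard]
    have h1 := waveBeep_add x 1 (a + 1) n
    have h2 := waveBeep_add x 1 a (n + 1)
    rw [show 1 + (a + 1) = a + 2 by omega, Nat.add_comm 1 n] at h1
    rw [show 1 + (n + 1) = n + 2 by omega, Nat.add_comm 1 a] at h2
    rw [h1, h2]
    cases hA : waveBeep x a (n + 1)
    · cases waveBeep x (a + 1) n <;> simp
    · have hB : waveBeep x (a + 1) n = false := by
        by_contra hB
        rw [Bool.not_eq_false, waveBeep_eq_true] at hB
        rw [waveBeep_eq_true] at hA
        omega
      simp [hB]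

/-- The code starts with 1, so the first beep marks the arrival; sampling every third step from
there misses the echoes, which are shifted by 2. -/
theorem received_waveHeard (m : List Bool) (c : Bool) (a n : ℕ) :
    received (record (waveHeard (encode m) c a) n) =
      if a + 3 * ((encode m).length - 1) < n then some m else none := by
  have hlen := encode_length m
  have hpre : ∀ i < a, waveHeard (encode m) c a i = false := fun i hi => by
    simp [waveHeard, waveBeep_of_lt hi, waveBeep_of_lt (show i < a + 2 by omega)]
  have ha : waveHeard (encode m) c a a = true := by
    rw [waveHeard, Bool.or_eq_true]
    exact Or.inl (waveBeep_eq_true.2 ⟨le_rfl, by simp, by rw [Nat.sub_self]; exact encode_getD_zero m⟩)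
  rcases Nat.lt_or_ge a n with han | han
  · rw [received, idxOf_record_of_first ha hpre han]
    obtain ⟨d, rfl⟩ := Nat.exists_eq_add_of_lt han
    rw [Nat.add_assoc, record_add, List.drop_left' (by simp), everyThird_record]
    have hcode : record (fun i => waveHeard (encode m) c a (a + 3 * i)) ((d + 1 + 2) / 3) =
        record (fun i => (encode m).getD i false) ((d + 1 + 2) / 3) := by
      apply record_congr
      intro i _
      have h1 : waveBeep (encode m) (a + 2) (a + 3 * i) = false := by
        by_contra h
        rw [Bool.not_eq_false, waveBeep_eq_true] at h
        omega
      rw [waveHeard, h1]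
      simp [waveBeep]
    rw [hcode, record_getD]
    split_ifs with h
    · rw [List.take_of_length_le (by omega), decode_encode_append]
    · rw [show (d + 1 + 2) / 3 - (encode m).length = 0 by omega, List.replicate_zero,
        List.append_nil, decode_take_encode _ _ (by omega)]
  · rw [received, idxOf_record_of_none fun i hi => hpre i (by omega), if_neg (by omega),
      List.drop_eq_nil_of_le (by simp)]
    simp [everyThird, decode]

theorem beepWave_relay (m m' : List Bool) (dl : List Bool → ℕ) (c : Bool) (a n : ℕ)
    (hn : n < dl m) : beepWave false m' dl (record (waveHeard (encode m) c a) n) =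
      act (waveBeep (encode m) (a + 1) n) := by
  simp only [beepWave, Bool.false_eq_true, if_false, received_waveHeard, relayRev_waveHeard,
    record_length]
  split_ifs <;> simp
  omega

theorem beepWave_relay_halt (m m' : List Bool) (dl : List Bool → ℕ) (c : Bool) (a : ℕ)
    (hdl : a + 3 * (encode m).length ≤ dl m) :
    beepWave false m' dl (record (waveHeard (encode m) c a) (dl m)) = .halt (m, a + 1) := by
  have hlen := encode_length m
  simp only [beepWave, Bool.false_eq_true, if_false, received_waveHeard, record_length]
  rw [if_pos (by omega)]
  simp only [le_refl, if_true]
  rw [idxOf_record_of_first (j := a) _ _ (by omega)]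
  · rw [waveHeard, Bool.or_eq_true]
    exact Or.inl (waveBeep_eq_true.2 ⟨le_rfl, by simp, by rw [Nat.sub_self]; exact encode_getD_zero m⟩)
  · intro i hi
    simp [waveHeard, waveBeep_of_lt hi, waveBeep_of_lt (show i < a + 2 by omega)]

theorem beepWave_source (m : List Bool) (dl : List Bool → ℕ) (f : ℕ → Bool) (n : ℕ)
    (hn : n < dl m) : beepWave true m dl (record f n) = act (waveBeep (encode m) 0 n) := by
  simp only [beepWave, if_true, record_length, waveBeep]
  rw [if_neg (by omega)]
  simp [Bool.beq_eq_decide_eq]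

theorem beepWave_source_halt (m : List Bool) (dl : List Bool → ℕ) (f : ℕ → Bool) :
    beepWave true m dl (record f (dl m)) = .halt (m, 0) := by
  simp [beepWave]

section Graph

variable {V α : Type} {G : SimpleGraph V}

theorem level_cases (hG : G.Connected) (l : V) {v w : V} (h : G.Adj v w) :
    G.dist l w = G.dist l v ∨ G.dist l w = G.dist l v + 1 ∨ G.dist l v = G.dist l w + 1 := by
  have h1 := dist_adj_le hG h l
  have h2 := dist_adj_le hG h.symm l
  omega

open Classical in
theorem hears_wave (hG : G.Connected) (l : V) (x : List Bool) (t₀ t : ℕ) {B : V → ℕ → Bool}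
    (hB : ∀ v, B v t = waveBeep x (t₀ + G.dist l v) t) {v : V} {j : ℕ} (hv : G.dist l v = j + 1) :
    hears G B v t =
      waveHeard x (decide (∃ w, G.Adj v w ∧ G.dist l w = G.dist l v + 1)) (t₀ + j) t := by
  rw [Bool.eq_iff_iff, hears_eq_true]
  simp only [hB, waveHeard, Bool.or_eq_true, Bool.and_eq_true, decide_eq_true_eq]
  constructor
  · rintro ⟨h1, w, hw, h2⟩
    rcases level_cases hG l hw with h | h | h
    · rw [h, h1] at h2
      simp at h2
    · right
      refine ⟨⟨w, hw, h⟩, ?_⟩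
      rwa [h, hv] at h2
    · left
      rwa [show G.dist l w = j by omega] at h2
  · rintro (h | ⟨⟨w, hw, hd⟩, h⟩)
    · obtain ⟨w, hw, hd⟩ := exists_adj_dist_of_pos hG (u := l) (v := v) (by omega)
      refine ⟨?_, w, hw, ?_⟩
      · by_contra hc
        rw [Bool.not_eq_false, waveBeep_eq_true] at hc
        rw [waveBeep_eq_true] at h
        omega
      · rwa [show G.dist l w = j by omega]
    · refine ⟨?_, w, hw, ?_⟩
      · by_contra hc
        rw [Bool.not_eq_false, waveBeep_eq_true] at hc
        rw [waveBeep_eq_true] at h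
        omega
      · rwa [hd, hv]

/-- A beep wave from `l` after a stage in which the nodes terminate at different times `s v`,
before the wave reaches them. -/
theorem bind_beepWave_haltsAt (hG : G.Connected) {l : V} {lead : V → Bool}
    (hlead : ∀ v, lead v = true ↔ v = l) {P : V → Program α} {B : V → ℕ → Bool} {s : V → ℕ}
    {out : V → α} (hP : ∀ v, ∀ t < s v, P v (record (hears G B v) t) = act (B v t))
    (hs : ∀ v, P v (record (hears G B v) (s v)) = .halt (out v))
    (hsl : ∀ v, s v ≤ s l + (G.dist l v - 1))
    (hquiet : ∀ v, v ≠ l → ∀ t, s v ≤ t → B v t = false ∧ hears G B v t = false)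
    (hquiet' : ∀ v t, s l ≤ t → B v t = false)
    {m : V → α → List Bool} {dl : V → α → List Bool → ℕ} {T : ℕ}
    (hdl : ∀ v, dl v (out v) (m l (out l)) + s v = T)
    (hT : ∀ v, s l + G.dist l v + 3 * (encode (m l (out l))).length ≤ T) (v : V) :
    HaltsAt G (fun v => P v >>= fun t => beepWave (lead v) (m v t) (dl v t)) T v
      (m l (out l), s l + G.dist l v - s v) := by
  classical
  set M := m l (out l) with hM
  -- The combined pattern: the old stage until the source stops, the wave from then on.
  set B' : V → ℕ → Bool := fun v t =>
    if t < s l then B v t else waveBeep (encode M) (s l + G.dist l v) t with hB'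
  -- Neighbours of `v` are at distance at least `dist l v - 1`, so none of them has started the wave
  -- yet.
  have hhear : ∀ v t, t < s l + (G.dist l v - 1) → hears G B' v t = hears G B v t := by
    intro v t ht
    have hloc : ∀ w, G.dist l v ≤ G.dist l w + 1 → B' w t = B w t := by
      intro w hw
      simp only [hB']
      split_ifs with h
      · rfl
      · rw [hquiet' w t (by omega), waveBeep_of_lt (by omega)]
    have hw : ∀ w, G.Adj v w → B' w t = B w t := fun w hw => hloc w (by
      rcases level_cases hG l hw with h | h | h <;> omega)
    rw [Bool.eq_iff_iff, hears_eq_true, hears_eq_true, hloc v (by omega)]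
    refine and_congr_right fun _ => exists_congr fun w => and_congr_right fun h => ?_
    rw [hw w h]
  have hrec : ∀ v t, t ≤ s v → record (hears G B' v) t = record (hears G B v) t := fun v t ht =>
    record_congr fun i hi => hhear v i (by have := hsl v; omega)
  have hrun : ∀ v, ∀ t ≤ s v, ∀ k < (record (hears G B' v) t).length, ∀ b,
      P v ((record (hears G B' v) t).take k) ≠ .halt b := by
    intro v t ht k hk b
    rw [record_length] at hk
    rw [record_take_of_le _ hk.le, hrec v k (by omega), hP v k (by omega)]
    exact act_ne_halt
  have hafter : ∀ v t, s v ≤ t →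
      (P v >>= fun t => beepWave (lead v) (m v t) (dl v t)) (record (hears G B' v) t) =
        beepWave (lead v) (m v (out v)) (dl v (out v))
          (record (fun i => hears G B' v (s v + i)) (t - s v)) := by
    intro v t ht
    rw [show t = s v + (t - s v) by omega, record_add, Nat.add_sub_cancel_left]
    refine andThen_append _ _ _ _ (hrun v (s v) le_rfl) ?_
    rw [hrec v _ le_rfl, hs]
  -- Seen from the local clock starting at `s v`, this is a plain wave with a shifted arrival; the
  -- gap before it is silent by `hquiet`.
  have hrelay : ∀ v, v ≠ l → ∀ n, record (fun i => hears G B' v (s v + i)) n =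
      record (waveHeard (encode M) (decide (∃ w, G.Adj v w ∧ G.dist l w = G.dist l v + 1))
        (s l + (G.dist l v - 1) - s v)) n := by
    intro v hv n
    have hpos := hG.pos_dist_of_ne (Ne.symm hv)
    apply record_congr
    intro i _
    have h1 := hsl v
    rcases Nat.lt_or_ge (s v + i) (s l) with h | h
    · rw [hhear _ _ (by omega), (hquiet v hv _ (by omega)).2, waveHeard, waveBeep_of_lt (by omega),
        waveBeep_of_lt (by omega)]
      simp
    · rw [hears_wave hG l (encode M) (s l) (s v + i) (j := G.dist l v - 1) _ (by omega)]
      · obtain ⟨a, ha⟩ := Nat.exists_eq_add_of_le h1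
        rw [ha, Nat.add_sub_cancel_left, waveHeard, waveHeard, waveBeep_add, Nat.add_assoc,
          waveBeep_add]
      · intro w
        simp only [hB']
        rw [if_neg (by omega)]
  have hbeep : ∀ v t, s v ≤ t → v ≠ l → waveBeep (encode M) (s l + (G.dist l v - 1) - s v + 1)
      (t - s v) = B' v t := by
    intro v t ht hv
    have hpos := hG.pos_dist_of_ne (Ne.symm hv)
    have h1 := hsl v
    rw [← waveBeep_add _ (s v), show s v + (t - s v) = t by omega,
      show s v + (s l + (G.dist l v - 1) - s v + 1) = s l + G.dist l v by omega]
    simp only [hB']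
    split_ifs with h
    · rw [waveBeep_of_lt (by omega)]
      exact (hquiet v hv t ht).1.symm
    · rfl
  refine haltsAt_of_pattern (B := B') (a := fun v => (M, s l + G.dist l v - s v)) ?_ ?_ v
  · intro t ht v
    rcases Nat.lt_or_ge t (s v) with htv | htv
    · rw [bind_eq_andThen, andThen_of_running _ _ _ (hrun v t htv.le), hrec v t htv.le, hP v t htv]
      have : B' v t = B v t := by
        simp only [hB']
        split_ifs with h
        · rfl
        · have := hsl v
          rw [hquiet' v t (by omega), waveBeep_of_lt (by omega)]
      rw [this]
      cases B v t <;> rfl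
    · rw [hafter v t htv]
      by_cases hv : v = l
      · subst hv
        rw [(hlead v).2 rfl, ← hM, beepWave_source _ _ _ _ (by have := hdl v; omega)]
        simp only [hB']
        rw [if_neg (by omega), ← waveBeep_add _ (s v), show s v + (t - s v) = t by omega]
        simp
      · have hl : lead v = false := by
          rw [← Bool.not_eq_true, hlead]
          exact hv
        have h1 := hdl v
        have h2 := hT v
        have h3 := hsl v
        rw [hl, hrelay v hv, beepWave_relay _ _ _ _ _ _ (by omega), hbeep v t htv hv]
  · intro v
    have h1 := hdl v
    have h2 := hT v
    have h3 := hsl v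
    rw [hafter v T (by omega), show T - s v = dl v (out v) M by omega]
    by_cases hv : v = l
    · subst hv
      rw [(hlead v).2 rfl, beepWave_source_halt]
      simp [hM]
    · have hpos := hG.pos_dist_of_ne (Ne.symm hv)
      have hl : lead v = false := by
        rw [← Bool.not_eq_true, hlead]
        exact hv
      rw [hl, hrelay v hv, beepWave_relay_halt _ _ _ _ _ (by omega)]
      congr 2
      omega

theorem beepWave_haltsAt (hG : G.Connected) {l : V} {lead : V → Bool}
    (hlead : ∀ v, lead v = true ↔ v = l) (m : V → List Bool) {dl : List Bool → ℕ}
    (hT : ∀ v, G.dist l v + 3 * (encode (m l)).length ≤ dl (m l)) (v : V) :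
    HaltsAt G (fun v => beepWave (lead v) (m v) dl) (dl (m l)) v (m l, G.dist l v) := by
  have hpure : ∀ (p : Program (List Bool × ℕ)), ((pure () : Program Unit) >>= fun _ => p) = p := by
    intro p
    funext h
    cases h <;> rfl
  have := bind_beepWave_haltsAt hG hlead (P := fun _ => (pure () : Program Unit))
    (B := fun _ _ => false) (s := fun _ => 0) (out := fun _ => ()) (m := fun v _ => m v)
    (dl := fun _ _ => dl) (T := dl (m l)) (by simp) (fun _ => rfl) (by simp)
    (by simp [hears]) (by simp) (by simp) (by simpa using hT) v
  simpa [hpure] using this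

end Graph

/-- Lets a first stage and the wave after it be treated as one unit before the output is
post-processed. -/
theorem bind_assoc_program {α β γ : Type} (p : Program α) (q : α → Program β) (r : β → Program γ) :
    (p >>= q) >>= r = p >>= fun a => q a >>= r := by
  funext h
  change Program.andThen r (Program.andThen q p) h =
    Program.andThen (fun a => Program.andThen r (q a)) p h
  induction h generalizing p with
  | nil =>
    simp only [Program.andThen]
    cases p [] <;> rfl
  | cons b h ih =>
    cases hp : p [] with
    | halt a =>
      have h1 : ∀ l, Program.andThen q p l = q a l := fun l =>
        andThen_append q p [] l (by simp) hp
      rw [show Program.andThen q p = q a from funext h1]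
      exact (andThen_append (fun a => Program.andThen r (q a)) p [] (b :: h) (by simp) hp).symm
    | beep =>
      have := ih fun l => p (b :: l)
      simp only [Program.andThen, hp]
      exact this
    | listen =>
      have := ih fun l => p (b :: l)
      simp only [Program.andThen, hp]
      exact this

theorem ofBits_append (l : List Bool) (b : Bool) : ofBits (l ++ [b]) = 2 * ofBits l + b.toNat := by
  simp [ofBits]

theorem toBits_succ (w x : ℕ) : toBits (w + 1) x = toBits w (x / 2) ++ [x.testBit 0] := by
  simp only [toBits, List.range_succ, List.map_append, List.map_cons, List.map_nil]
  congr 1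
  · apply List.map_congr_left
    intro i hi
    rw [List.mem_range] at hi
    rw [← Nat.testBit_succ]
    congr 1
    omega
  · simp

theorem ofBits_toBits (w : ℕ) : ∀ x < 2 ^ w, ofBits (toBits w x) = x := by
  induction w with
  | zero => intro x hx; simp [toBits, ofBits]; simp at hx; omega
  | succ w ih =>
    intro x hx
    rw [toBits_succ, ofBits_append, ih _ (by rw [pow_succ] at hx; omega), Nat.testBit_zero]
    have := Nat.mod_two_eq_zero_or_one x
    rcases this with h | h <;> simp [h] <;> omega

theorem toBits_length (w x : ℕ) : (toBits w x).length = w := by simp [toBits]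

theorem quiet_record (rule : List Bool → Bool) (f : ℕ → Bool) (t : ℕ) :
    quiet rule (record f t) = true ↔
      3 ≤ t ∧ ∀ i, t ≤ i + 3 → i < t → rule (record f i) = false ∧ f i = false := by
  simp only [quiet, Bool.and_eq_true, decide_eq_true_eq, record_length, List.all_eq_true,
    List.mem_range, Bool.or_eq_true, Bool.not_eq_true', heard_record]
  refine and_congr_right fun _ => forall_congr' fun i => ?_
  constructor
  · intro h h1 h2
    have := h h2
    rw [record_take_of_le _ h2.le] at this
    simp only [h2, decide_true, Bool.true_and] at this
    rcases this with h | h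
    · omega
    · exact ⟨h.2, h.1⟩
  · intro h h2
    rw [record_take_of_le _ h2.le]
    simp only [h2, decide_true, Bool.true_and]
    by_cases h1 : t ≤ i + 3
    · exact Or.inr ⟨(h h1 h2).2, (h h1 h2).1⟩
    · left; omega

/-! ### Geodesics away from the leader, and local quiescence. -/

section Graph

variable {V : Type} {G : SimpleGraph V}

/-- `u` can be reached from `v` along a path that leads away from `l`. -/
def Beyond (G : SimpleGraph V) (l v u : V) : Prop := G.dist l u = G.dist l v + G.dist v u

theorem beyond_refl (l v : V) : Beyond G l v v := by simp [Beyond]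

theorem Beyond.of_child (hG : G.Connected) {l v w u : V} (hvw : G.Adj v w)
    (hw : G.dist l w = G.dist l v + 1) (h : Beyond G l w u) :
    Beyond G l v u ∧ G.dist v u = G.dist w u + 1 := by
  unfold Beyond at *
  have h1 := hG.dist_triangle (u := l) (v := v) (w := u)
  have h2 := dist_adj_le hG hvw u
  rw [SimpleGraph.dist_comm, SimpleGraph.dist_comm (v := w)] at h2
  omega

theorem Beyond.exists_child (hG : G.Connected) {l v u : V} (h : Beyond G l v u)
    (hd : 0 < G.dist v u) : ∃ w, G.Adj v w ∧ G.dist l w = G.dist l v + 1 ∧ Beyond G l w u ∧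
      G.dist v u = G.dist w u + 1 := by
  obtain ⟨w, hw, hwd⟩ := exists_adj_dist_of_pos hG (u := u) (v := v)
    (by rwa [SimpleGraph.dist_comm])
  rw [SimpleGraph.dist_comm (v := w), SimpleGraph.dist_comm (v := v)] at hwd
  have h1 := hG.dist_triangle (u := l) (v := w) (w := u)
  have h2 := dist_adj_le hG hw.symm l
  unfold Beyond at *
  exact ⟨w, hw, by omega, by omega, by omega⟩

/-- If a node and its neighbours beep periodically until they stop, silence during a period means
that they have stopped. -/
theorem silent_of_quiet {B : V → ℕ → Bool} {v : V} {s : ℕ} (hs : 3 ≤ s)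
    (hq : ∀ i, s ≤ i + 3 → i < s → B v i = false ∧ hears G B v i = false)
    (hper : ∀ w, (w = v ∨ G.Adj v w) → ∀ t, s ≤ t → B w t = true →
      ∀ i, s ≤ i + 3 → i < s → i % 3 = t % 3 → B w i = true)
    {t : ℕ} (ht : s ≤ t) : B v t = false ∧ hears G B v t = false := by
  -- The three silent steps represent all residues modulo 3; `i` is the one congruent to `t`.
  obtain ⟨i, hi1, hi2, hi3⟩ : ∃ i, s ≤ i + 3 ∧ i < s ∧ i % 3 = t % 3 :=
    ⟨s - 3 + (t - (s - 3)) % 3, by omega, by omega, by omega⟩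
  obtain ⟨hq1, hq2⟩ := hq i hi1 hi2
  have hv : B v t = false := by
    by_contra h
    rw [Bool.not_eq_false] at h
    rw [hper v (Or.inl rfl) t ht h i hi1 hi2 hi3] at hq1
    exact Bool.noConfusion hq1
  refine ⟨hv, hears_eq_false.2 fun _ w hw => ?_⟩
  by_contra h
  rw [Bool.not_eq_false] at h
  have := hears_eq_false.1 hq2 hq1 w hw
  rw [hper w (Or.inr hw) t ht h i hi1 hi2 hi3] at this
  exact Bool.noConfusion this

/-! ### Diameter estimation -/

open Classical in
/-- The beeps of `probeRule` if no node ever stops. -/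
noncomputable def probeBeep (G : SimpleGraph V) (l v : V) (t : ℕ) : Bool :=
  if v = l then decide (t = 1) else
    decide (t = G.dist l v + 1 ∨ ((t + G.dist l v) % 3 = 0 ∧ G.dist l v < t ∧
      ∃ u, Beyond G l v u ∧ t ≤ G.dist l v + 2 * G.dist v u + 3))

theorem probeBeep_leader {l : V} {t : ℕ} : probeBeep G l l t = true ↔ t = 1 := by
  simp [probeBeep]

theorem probeBeep_of_ne {l v : V} (hv : v ≠ l) {t : ℕ} :
    probeBeep G l v t = true ↔ t = G.dist l v + 1 ∨ ((t + G.dist l v) % 3 = 0 ∧ G.dist l v < t ∧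
      ∃ u, Beyond G l v u ∧ t ≤ G.dist l v + 2 * G.dist v u + 3) := by
  simp [probeBeep, hv]

theorem probeBeep_relay (l v : V) : probeBeep G l v (G.dist l v + 1) = true := by
  by_cases hv : v = l
  · subst hv; simp [probeBeep_leader]
  · exact (probeBeep_of_ne hv).2 (Or.inl rfl)

theorem lt_of_probeBeep {l v : V} {t : ℕ} (h : probeBeep G l v t = true) : G.dist l v < t := by
  by_cases hv : v = l
  · subst hv; rw [probeBeep_leader] at h; simp [h]
  · rcases (probeBeep_of_ne hv).1 h with h | h
    · omega
    · exact h.2.1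

theorem probe_hears_of_lt (hG : G.Connected) {l v : V} {i : ℕ} (hi : i < G.dist l v) :
    hears G (probeBeep G l) v i = false := by
  rw [hears_eq_false]
  intro _ w hw
  by_contra h
  rw [Bool.not_eq_false] at h
  have h1 := lt_of_probeBeep h
  have h2 := dist_adj_le hG hw l
  omega

theorem probe_hears_first (hG : G.Connected) {l v : V} (hv : v ≠ l) :
    hears G (probeBeep G l) v (G.dist l v) = true := by
  obtain ⟨w, hw, hd⟩ := exists_adj_dist_of_pos hG (hG.pos_dist_of_ne hv.symm)
  refine hears_eq_true.2 ⟨?_, w, hw, ?_⟩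
  · by_contra h
    rw [Bool.not_eq_false] at h
    exact absurd (lt_of_probeBeep h) (lt_irrefl _)
  · rw [← hd]
    exact probeBeep_relay l w

/-- By residues, only neighbours one level farther out acknowledge in step `t - 1`; the second
hypothesis on `t` excludes the first beeps of the outgoing probe. -/
theorem probe_hears_ack (hG : G.Connected) {l v : V} (hv : v ≠ l) {t : ℕ}
    (ht : (t + G.dist l v) % 3 = 0) (hlt : G.dist l v + 3 < t) :
    hears G (probeBeep G l) v (t - 1) = true ↔
      ∃ u, Beyond G l v u ∧ t ≤ G.dist l v + 2 * G.dist v u + 3 := by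
  have hpos := hG.pos_dist_of_ne hv.symm
  rw [hears_eq_true]
  constructor
  · rintro ⟨-, w, hw, h⟩
    by_cases hwl : w = l
    · subst hwl
      rw [probeBeep_leader] at h
      omega
    · rcases (probeBeep_of_ne hwl).1 h with h | ⟨h1, h2, u, hu, h3⟩
      · rcases level_cases hG l hw with h' | h' | h' <;> omega
      · have hlev : G.dist l w = G.dist l v + 1 := by
          rcases level_cases hG l hw with h' | h' | h' <;> omega
        obtain ⟨h4, h5⟩ := hu.of_child hG hw hlev
        exact ⟨u, h4, by omega⟩
  · rintro ⟨u, hu, h⟩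
    constructor
    · rw [← Bool.not_eq_true, probeBeep_of_ne hv]
      omega
    · obtain ⟨w, hw, h1, h2, h3⟩ := hu.exists_child hG (by omega)
      refine ⟨w, hw, (probeBeep_of_ne ?_).2 (Or.inr ⟨by omega, by omega, u, h2, by omega⟩)⟩
      rintro rfl
      simp at h1

variable {l : V} {lead : V → Bool}

theorem probeRule_record (hG : G.Connected) (hlead : ∀ v, lead v = true ↔ v = l) (v : V) (t : ℕ) :
    probeRule (lead v) (record (hears G (probeBeep G l) v) t) = probeBeep G l v t := by
  by_cases hv : v = l
  · subst hv
    rw [(hlead v).2 rfl]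
    simp [probeRule, probeBeep, Bool.beq_eq_decide_eq]
  · have hl : lead v = false := by
      rw [← Bool.not_eq_true, hlead]
      exact hv
    rw [hl, Bool.eq_iff_iff, probeBeep_of_ne hv]
    rcases Nat.lt_or_ge (G.dist l v) t with ht | ht
    · simp only [probeRule, record_length,
        idxOf_record_of_first (probe_hears_first hG hv) (fun i hi => probe_hears_of_lt hG hi) ht,
        heard_record, Bool.false_eq_true, if_false, ht, decide_true, Bool.true_and,
        Bool.or_eq_true, beq_iff_eq, Bool.and_eq_true, decide_eq_true_eq]
      refine or_congr_right (and_congr_right fun hm => ?_)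
      simp only [true_and]
      rcases Nat.lt_or_ge (G.dist l v + 3) t with h | h
      · rw [probe_hears_ack hG hv hm h]
        have h1 : ¬t ≤ G.dist l v + 3 := by omega
        have h2 : t - 1 < t := by omega
        simp [h1, h2]
      · exact iff_of_true (Or.inl h) ⟨v, beyond_refl l v, by omega⟩
    · simp only [probeRule, record_length,
        idxOf_record_of_none (fun i hi => probe_hears_of_lt hG (hi.trans_le ht)),
        lt_irrefl, decide_false, Bool.false_and, Bool.false_eq_true, if_false, false_iff]
      omega

/-- Node `v` may stop probing after `t` time-steps. -/
def ProbeStop (G : SimpleGraph V) (l v : V) (t : ℕ) : Prop :=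
  (v = l ∨ G.dist l v < t) ∧ 3 ≤ t ∧ ∀ i, t ≤ i + 3 → i < t →
    probeBeep G l v i = false ∧ hears G (probeBeep G l) v i = false

open Classical in
theorem probe_record (hG : G.Connected) (hlead : ∀ v, lead v = true ↔ v = l) (v : V) (t : ℕ) :
    probe (lead v) (record (hears G (probeBeep G l) v) t) =
      if ProbeStop G l v t then .halt t else act (probeBeep G l v t) := by
  have hcond : ((lead v || (record (hears G (probeBeep G l) v) t).contains true) &&
      quiet (probeRule (lead v)) (record (hears G (probeBeep G l) v) t)) = true ↔
      ProbeStop G l v t := by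
    rw [Bool.and_eq_true, quiet_record, Bool.or_eq_true, hlead, contains_record, ProbeStop]
    simp only [probeRule_record hG hlead]
    refine and_congr_left fun _ => ?_
    by_cases hv : v = l
    · simp [hv]
    · simp only [hv, false_or]
      constructor
      · rintro ⟨i, hi, h⟩
        by_contra hc
        rw [probe_hears_of_lt hG (by omega)] at h
        exact Bool.noConfusion h
      · exact fun h => ⟨_, h, probe_hears_first hG hv⟩
  simp only [probe, record_length, probeRule_record hG hlead]
  by_cases h : ProbeStop G l v t
  · rw [if_pos (hcond.2 h), if_pos h]
  · rw [if_neg (mt hcond.1 h), if_neg h]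

/-- A neighbour of `l` on a geodesic to `u` beeps in all steps congruent to 2 modulo 3 up to `2 *
dist l u + 2`. Stopping too early would put such a step among the last three. -/
theorem probeStop_leader_ge (hG : G.Connected) {t : ℕ} (h : ProbeStop G l l t) (u : V) :
    2 * G.dist l u + 4 ≤ t := by
  obtain ⟨-, h3, hq⟩ := h
  have h5 : 5 ≤ t := by
    by_contra hc
    have := (hq 1 (by omega) (by omega)).1
    rw [probeBeep_leader.2 rfl] at this
    exact Bool.noConfusion this
  by_cases hu : u = l
  · subst hu
    simp
    omega
  by_contra hc
  obtain ⟨w, hw, h1, h2, h4⟩ := Beyond.exists_child hG (l := l) (v := l) (u := u) (by simp [Beyond])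
    (hG.pos_dist_of_ne (Ne.symm hu))
  rw [SimpleGraph.dist_self, zero_add] at h1
  obtain ⟨i, hi1, hi2, hi3⟩ : ∃ i, t ≤ i + 3 ∧ i < t ∧ i % 3 = 2 :=
    ⟨t - 3 + (2 + 2 * (t - 3)) % 3, by omega, by omega, by omega⟩
  obtain ⟨hq1, hq2⟩ := hq i hi1 hi2
  have := hears_eq_false.1 hq2 hq1 w hw
  rw [← Bool.not_eq_true] at this
  apply this
  refine (probeBeep_of_ne ?_).2 (Or.inr ⟨by omega, by omega, u, h2, by omega⟩)
  rintro rfl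
  exact G.loopless.irrefl _ hw

/-- A beep in step `t` at distance `j ≥ 1` satisfies `t + j < t₀`, which suffices for `j ≥ 3`. For
`j = 1` the listening leader would hear it; for `j = 2` an acknowledgement is repeated one step
later at distance 1. -/
theorem probeBeep_le_of_probeStop (hG : G.Connected) {t₀ : ℕ} (h : ProbeStop G l l t₀) {v : V} {t : ℕ}
    (ht : probeBeep G l v t = true) : t + 4 ≤ t₀ := by
  have hge := probeStop_leader_ge hG h
  obtain ⟨-, h3, hq⟩ := h
  have h5 : 5 ≤ t₀ := by
    by_contra hc
    have := (hq 1 (by omega) (by omega)).1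
    rw [probeBeep_leader.2 rfl] at this
    exact Bool.noConfusion this
  have hb : ∀ v t, v ≠ l → probeBeep G l v t = true → t + G.dist l v + 1 ≤ t₀ := by
    intro v t hv ht
    have := hge v
    rcases (probeBeep_of_ne hv).1 ht with h | ⟨-, -, u, hu, h⟩
    · omega
    · have := hge u
      unfold Beyond at hu
      omega
  have h1 : ∀ v t, G.dist l v = 1 → probeBeep G l v t = true → t + 4 ≤ t₀ := by
    intro v t hv ht
    have hadj := SimpleGraph.dist_eq_one_iff_adj.1 hv
    have hb := hb v t hadj.ne' ht
    have hlt := lt_of_probeBeep ht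
    by_contra hc
    obtain ⟨hq1, hq2⟩ := hq t (by omega) (by omega)
    have := hears_eq_false.1 hq2 hq1 v hadj
    rw [ht] at this
    exact Bool.noConfusion this
  by_cases hv : v = l
  · subst hv
    rw [probeBeep_leader] at ht
    omega
  have hpos := hG.pos_dist_of_ne (Ne.symm hv)
  have hbv := hb v t hv ht
  by_cases hv1 : G.dist l v = 1
  · exact h1 v t hv1 ht
  by_cases hv2 : G.dist l v = 2
  · have := hge v
    rcases (probeBeep_of_ne hv).1 ht with h | ⟨hm, hlt, u, hu, h⟩
    · omega
    · obtain ⟨w, hw, hd⟩ := exists_adj_dist_of_pos hG hpos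
      obtain ⟨hu1, hu2⟩ := hu.of_child hG hw.symm hd.symm
      have := h1 w (t + 1) (by omega) ((probeBeep_of_ne (by rintro rfl; simp at hd; omega)).2
        (Or.inr ⟨by omega, by omega, u, hu1, by omega⟩))
      omega
  · omega

theorem probeStop_of_le (hG : G.Connected) {t₀ : ℕ} (h : ProbeStop G l l t₀) (v : V) :
    ProbeStop G l v t₀ := by
  have hge := probeStop_leader_ge hG h v
  have hsil : ∀ w i, t₀ ≤ i + 3 → probeBeep G l w i = false := by
    intro w i hi
    by_contra hc
    rw [Bool.not_eq_false] at hc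
    have := probeBeep_le_of_probeStop hG h hc
    omega
  exact ⟨Or.inr (by omega), by omega, fun i hi _ =>
    ⟨hsil v i hi, hears_eq_false.2 fun _ w _ => hsil w i hi⟩⟩

/-- Quiescence at `s` forces `s ≥ dist l v + 5`, beyond the outgoing probe in the neighbourhood.
What remains are acknowledgements, which fill their residue class without gaps up to the last one,
so `silent_of_quiet` applies. -/
theorem probe_silent_of_quiescent (hG : G.Connected) {v : V} (hv : v ≠ l) {s t : ℕ}
    (h : ProbeStop G l v s) (ht : s ≤ t) :
    probeBeep G l v t = false ∧ hears G (probeBeep G l) v t = false := by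
  obtain ⟨h0, h3, hq⟩ := h
  have h0 := h0.resolve_left hv
  have hpos := hG.pos_dist_of_ne (Ne.symm hv)
  have h5 : G.dist l v + 5 ≤ s := by
    by_contra hc
    by_cases hc' : G.dist l v + 4 = s
    · have := (hq (G.dist l v + 1) (by omega) (by omega)).1
      rw [probeBeep_relay] at this
      exact Bool.noConfusion this
    · have := (hq (G.dist l v) (by omega) (by omega)).2
      rw [probe_hears_first hG hv] at this
      exact Bool.noConfusion this
  refine silent_of_quiet h3 hq ?_ ht
  intro w hw t ht hB i hi1 hi2 hi3
  have hd : G.dist l w ≤ G.dist l v + 1 := by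
    rcases hw with rfl | hw
    · omega
    · exact dist_adj_le hG hw.symm l
  by_cases hwl : w = l
  · subst hwl
    rw [probeBeep_leader] at hB
    omega
  · rw [probeBeep_of_ne hwl] at hB ⊢
    rcases hB with hB | ⟨h1, h2, u, hu, h⟩
    · omega
    · exact Or.inr ⟨by omega, by omega, u, hu, by omega⟩

/-- Neighbours of the leader beep no later than step `2 * diam + 2`, unless it is the first relay in
step 2; three more silent steps follow. -/
theorem exists_probeStop_leader [Finite V] (hG : G.Connected) :
    ProbeStop G l l (2 * G.diam + 6) := by
  refine ⟨Or.inl rfl, by omega, fun i hi _ => ⟨?_, hears_eq_false.2 fun _ w hw => ?_⟩⟩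
  · rw [← Bool.not_eq_true, probeBeep_leader]
    omega
  · have h1 := SimpleGraph.dist_eq_one_iff_adj.2 hw
    rw [← Bool.not_eq_true, probeBeep_of_ne hw.ne', h1]
    rintro (h | ⟨-, -, u, hu, h⟩)
    · omega
    · have := dist_le_diam_of_finite hG l u
      unfold Beyond at hu
      omega

theorem estimateDiameter_haltsAt [Finite V] (hG : G.Connected)
    (hlead : ∀ v, lead v = true ↔ v = l) :
    ∃ D, (∀ u, 2 * G.dist l u + 4 ≤ D) ∧ D ≤ 2 * G.diam + 6 ∧
      ∀ v, HaltsAt G (fun v => estimateDiameter (lead v)) (D + waveTime D (toBits D.size D)) v D := by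
  classical
  have hex : ∀ v, ∃ t, ProbeStop G l v t := fun v =>
    ⟨_, probeStop_of_le hG (exists_probeStop_leader hG) v⟩
  set s : V → ℕ := fun v => Nat.find (hex v) with hs
  have hhalt : ∀ v, ProbeStop G l v (s v) := fun v => Nat.find_spec (hex v)
  have hmin : ∀ v, ∀ t < s v, ¬ProbeStop G l v t := fun v t ht => Nat.find_min (hex v) ht
  have hsl : ∀ v, s v ≤ s l := fun v => Nat.find_min' (hex v) (probeStop_of_le hG (hhalt l) v)
  have hge := probeStop_leader_ge hG (hhalt l)
  have hbits : ofBits (toBits (s l).size (s l)) = s l := ofBits_toBits _ _ (Nat.lt_size_self _)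
  refine ⟨s l, hge, Nat.find_min' (hex l) (exists_probeStop_leader hG), ?_⟩
  have hrun := bind_beepWave_haltsAt hG hlead (P := fun v => probe (lead v)) (B := probeBeep G l)
    (s := s) (out := s) (m := fun _ t => toBits t.size t)
    (dl := fun _ t m => ofBits m + waveTime (ofBits m) m - t)
    (T := s l + waveTime (s l) (toBits (s l).size (s l)))
    (fun v t ht => by rw [probe_record hG hlead, if_neg (hmin v t ht)])
    (fun v => by rw [probe_record hG hlead, if_pos (hhalt v)])
    (fun v => (hsl v).trans (Nat.le_add_right _ _))
    (fun v hv t ht => probe_silent_of_quiescent hG hv (hhalt v) ht)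
    (fun v t ht => by
      by_contra hc
      rw [Bool.not_eq_false] at hc
      have := probeBeep_le_of_probeStop hG (hhalt l) hc
      omega)
    (fun v => by have := hsl v; rw [hbits]; omega)
    (fun v => by have := hge v; simp only [waveTime]; omega)
  intro v
  have := HaltsAt.bind_pure hrun (fun _ x => ofBits x.1) v
  simp only [bind_assoc_program, hbits] at this
  exact this

end Graph

section Graph

variable {V : Type} {G : SimpleGraph V} {l : V} {lead : V → Bool}

/-! ### Message collection -/

open Classical in
/-- The beeps of `collectRule` if node `u` holds the bits `bit u`. -/
noncomputable def collectBeep (G : SimpleGraph V) (l : V) (D : ℕ) (bit : V → ℕ → Bool) (v : V)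
    (t : ℕ) : Bool :=
  decide (v ≠ l ∧ D ≤ t + G.dist l v ∧ (t + G.dist l v - D) % 3 = 0 ∧
    ∃ u, Beyond G l v u ∧ bit u ((t + G.dist l v - D) / 3) = true)

theorem collectBeep_eq_true {D : ℕ} {bit : V → ℕ → Bool} {v : V} {t : ℕ} :
    collectBeep G l D bit v t = true ↔ v ≠ l ∧ D ≤ t + G.dist l v ∧ (t + G.dist l v - D) % 3 = 0 ∧
      ∃ u, Beyond G l v u ∧ bit u ((t + G.dist l v - D) / 3) = true := by
  simp [collectBeep]

theorem collectBeep_leader (D : ℕ) (bit : V → ℕ → Bool) (t : ℕ) :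
    collectBeep G l D bit l t = false := by
  simp [collectBeep]

/-- Of all neighbours, only those one level farther out own the preceding slot, and there they
handle the same position `i`. -/
theorem collect_hears (hG : G.Connected) {D : ℕ} (hD : ∀ u, G.dist l u < D) (bit : V → ℕ → Bool)
    {v : V} {i t : ℕ} (ht : t + G.dist l v = D + 3 * i) :
    hears G (collectBeep G l D bit) v (t - 1) = true ↔
      ∃ u, Beyond G l v u ∧ u ≠ v ∧ bit u i = true := by
  have hDv := hD v
  rw [hears_eq_true]
  constructor
  · rintro ⟨-, w, hw, h⟩
    obtain ⟨-, h1, h2, u, hu, h⟩ := collectBeep_eq_true.1 h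
    have hlev : G.dist l w = G.dist l v + 1 := by
      rcases level_cases hG l hw with h' | h' | h' <;> omega
    obtain ⟨h4, h5⟩ := hu.of_child hG hw hlev
    refine ⟨u, h4, ?_, ?_⟩
    · rintro rfl
      simp at h5
    · rwa [show (t - 1 + G.dist l w - D) / 3 = i by omega] at h
  · rintro ⟨u, hu, huv, h⟩
    constructor
    · rw [← Bool.not_eq_true, collectBeep_eq_true]
      omega
    · obtain ⟨w, hw, h1, h2, -⟩ := hu.exists_child hG (hG.pos_dist_of_ne (Ne.symm huv))
      have := hD w
      refine ⟨w, hw, collectBeep_eq_true.2 ⟨?_, by omega, by omega, u, h2, ?_⟩⟩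
      · rintro rfl
        simp at h1
      · rwa [show (t - 1 + G.dist l w - D) / 3 = i by omega]

theorem collectRule_record (hG : G.Connected) {D : ℕ} (hD : ∀ u, G.dist l u < D)
    (bit : V → ℕ → Bool) {v : V} (hv : v ≠ l) (t : ℕ) :
    collectRule D (G.dist l v) (bit v) (record (hears G (collectBeep G l D bit) v) t) =
      collectBeep G l D bit v t := by
  rw [Bool.eq_iff_iff, collectBeep_eq_true]
  simp only [collectRule, record_length, Bool.and_eq_true, decide_eq_true_eq, beq_iff_eq,
    Bool.or_eq_true, heard_record, and_assoc, hv, ne_eq, not_false_eq_true, true_and]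
  refine and_congr_right fun h1 => and_congr_right fun h2 => ?_
  have hDv := hD v
  rw [collect_hears hG hD bit (i := (t + G.dist l v - D) / 3) (by omega)]
  constructor
  · rintro (h | ⟨-, u, hu, -, h⟩)
    · exact ⟨v, beyond_refl l v, h⟩
    · exact ⟨u, hu, h⟩
  · rintro ⟨u, hu, h⟩
    by_cases huv : u = v
    · subst huv
      exact Or.inl h
    · exact Or.inr ⟨by omega, u, hu, huv, h⟩

theorem collect_hears_leader (hG : G.Connected) {D : ℕ} (hD : ∀ u, G.dist l u < D)
    (bit : V → ℕ → Bool) (i : ℕ) :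
    hears G (collectBeep G l D bit) l (3 * i + D - 1) = true ↔ ∃ u, u ≠ l ∧ bit u i = true := by
  rw [collect_hears hG hD bit (i := i) (by rw [SimpleGraph.dist_self]; omega)]
  simp [Beyond]

open Classical in
theorem collectMessages_haltsAt (hG : G.Connected) (hlead : ∀ v, lead v = true ↔ v = l) {D : ℕ}
    (hD : ∀ u, G.dist l u < D) (p : ℕ) (m : V → List Bool) :
    ∃ r : V → List Bool,
      (r l = (List.range p).map fun i => decide (∃ u, (m u).getD i false = true)) ∧
      ∀ v, HaltsAt G (fun v => collectMessages (lead v) D p (m v))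
        (waveTime D [true] + (3 * p + D)) v (r v) := by
  set bit : V → ℕ → Bool := fun u i => (m u).getD i false with hbit
  set B := collectBeep G l D bit with hB
  refine ⟨fun v => (List.range p).map fun i => (m v).getD i false ||
    heard (record (hears G B v) (3 * p + D)) (3 * i + D - 1), ?_, ?_⟩
  · apply List.map_congr_left
    intro i hi
    rw [List.mem_range] at hi
    have h1 : 3 * i + D - 1 < 3 * p + D := by omega
    rw [heard_record, decide_eq_true h1, Bool.true_and, Bool.eq_iff_iff, Bool.or_eq_true,
      collect_hears_leader hG hD, decide_eq_true_iff]
    constructor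
    · rintro (h | ⟨u, -, h⟩)
      exacts [⟨l, h⟩, ⟨u, h⟩]
    · rintro ⟨u, h⟩
      by_cases hu : u = l
      · subst hu
        exact Or.inl h
      · exact Or.inr ⟨u, hu, h⟩
  · refine HaltsAt.bind (beepWave_haltsAt hG hlead (fun _ => [true]) fun v => ?_) fun v => ?_
    · have := hD v
      simp only [waveTime]
      omega
    · refine haltsAt_of_pattern (B := B) (a := fun v => (List.range p).map fun i =>
        (m v).getD i false || heard (record (hears G B v) (3 * p + D)) (3 * i + D - 1)) ?_ ?_ v
      · intro t ht v
        simp only [record_length]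
        rw [if_neg (by omega)]
        by_cases hv : v = l
        · subst hv
          rw [(hlead v).2 rfl, hB, collectBeep_leader]
          rfl
        · have hl : lead v = false := by
            rw [← Bool.not_eq_true, hlead]
            exact hv
          have := collectRule_record hG hD bit hv t
          simp only [hbit] at this
          rw [hl, this]
          rfl
      · intro v
        simp only [record_length]
        rw [if_pos le_rfl]

/-! ### The message length -/

/-- A node other than the leader may stop relaying unary strings after `t` time-steps. -/
def CollectStop (G : SimpleGraph V) (l : V) (D : ℕ) (bit : V → ℕ → Bool) (v : V) (t : ℕ) : Prop :=
  D + 3 ≤ t ∧ ∀ i, t ≤ i + 3 → i < t →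
    collectBeep G l D bit v i = false ∧ hears G (collectBeep G l D bit) v i = false

/-- In a unary string a 1 is preceded only by 1s, so a late beep implies beeps in all earlier slots;
`D + 3 ≤ s` ensures that the last three steps lie where positions are defined. -/
theorem collect_silent_of_quiescent {D : ℕ} {len : V → ℕ} {v : V} {s t : ℕ}
    (h : CollectStop G l D (fun u i => decide (i < len u)) v s) (ht : s ≤ t) :
    collectBeep G l D (fun u i => decide (i < len u)) v t = false ∧
      hears G (collectBeep G l D (fun u i => decide (i < len u))) v t = false := by
  obtain ⟨h3, hq⟩ := h
  refine silent_of_quiet (by omega) hq ?_ ht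
  intro w _ t ht hB i hi1 hi2 hi3
  obtain ⟨h1, h2, h4, u, hu, h5⟩ := collectBeep_eq_true.1 hB
  have h5 := of_decide_eq_true h5
  exact collectBeep_eq_true.2 ⟨h1, by omega, by omega, u, hu, decide_eq_true (by omega)⟩

theorem collectBeep_lt {D : ℕ} {len : V → ℕ} {w : ℕ}
    (hw : ∀ u, len u ≤ w) {v : V} {t : ℕ}
    (h : collectBeep G l D (fun u i => decide (i < len u)) v t = true) : t < 3 * w + D := by
  obtain ⟨h1, h2, h4, u, hu, h5⟩ := collectBeep_eq_true.1 h
  have h5 := of_decide_eq_true h5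
  have := hw u
  omega

theorem collectStop_of_le {D : ℕ} {len : V → ℕ} {w : ℕ}
    (hw : ∀ u, len u ≤ w) (v : V) :
    CollectStop G l D (fun u i => decide (i < len u)) v (D + 3 * (w + 1)) := by
  have hsil : ∀ v i, 3 * w + D ≤ i →
      collectBeep G l D (fun u i => decide (i < len u)) v i = false := by
    intro v i hi
    by_contra hc
    rw [Bool.not_eq_false] at hc
    have := collectBeep_lt hw hc
    omega
  exact ⟨by omega, fun i hi _ => ⟨hsil v i (by omega), hears_eq_false.2 fun _ w _ =>
    hsil w i (by omega)⟩⟩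

open Classical in
theorem collectOnes_record_of_ne (hG : G.Connected) {D : ℕ} (hD : ∀ u, G.dist l u < D)
    (len : V → ℕ) {v : V} (hv : v ≠ l) (t : ℕ) :
    collectOnes false D (G.dist l v) (len v)
      (record (hears G (collectBeep G l D fun u i => decide (i < len u)) v) t) =
      if CollectStop G l D (fun u i => decide (i < len u)) v t then .halt t
      else act (collectBeep G l D (fun u i => decide (i < len u)) v t) := by
  have hrule := collectRule_record hG hD (fun u i => decide (i < len u)) hv
  have hc : (D + 3 ≤ t ∧ quiet (collectRule D (G.dist l v) (fun i => decide (i < len v)))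
      (record (hears G (collectBeep G l D fun u i => decide (i < len u)) v) t) = true) ↔
      CollectStop G l D (fun u i => decide (i < len u)) v t := by
    rw [quiet_record]
    simp only [hrule, CollectStop]
    exact ⟨fun h => ⟨h.1, h.2.2⟩, fun h => ⟨h.1, by omega, h.2⟩⟩
  simp only [collectOnes, Bool.false_eq_true, if_false, record_length, hrule]
  by_cases h : CollectStop G l D (fun u i => decide (i < len u)) v t
  · rw [if_pos (hc.2 h), if_pos h]
  · rw [if_neg (mt hc.1 h), if_neg h]

/-- Position `i` reaches the leader in step `3 * i + D - 1`, four steps before the check at `D + 3 *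
(i + 1)`; the first 0 is at `i = w`. -/
theorem collectOnes_record_leader (hG : G.Connected) {D : ℕ} (hD : ∀ u, G.dist l u < D)
    {len : V → ℕ} {w : ℕ} (hw : ∀ u, len u ≤ w) (hw' : ∃ u, len u = w) (d : ℕ) {t : ℕ}
    (ht : t ≤ D + 3 * (w + 1)) :
    collectOnes true D d (len l)
      (record (hears G (collectBeep G l D fun u i => decide (i < len u)) l) t) =
      if t = D + 3 * (w + 1) then .halt t else .listen := by
  simp only [collectOnes, if_true, record_length, heard_record]
  refine if_congr ?_ rfl rfl
  constructor
  · rintro ⟨h1, h2, h3, h4⟩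
    obtain ⟨i, rfl⟩ : ∃ i, t = D + 3 * (i + 1) := ⟨(t - D) / 3 - 1, by omega⟩
    have h5 : D + 3 * (i + 1) - 4 < D + 3 * (i + 1) := by omega
    rw [decide_eq_true h5, Bool.true_and, ← Bool.not_eq_true,
      show D + 3 * (i + 1) - 4 = 3 * i + D - 1 by omega, collect_hears_leader hG hD] at h4
    obtain ⟨u, hu⟩ := hw'
    have : w ≤ i := by
      by_contra hc
      by_cases hul : u = l
      · subst hul
        omega
      · exact h4 ⟨u, hul, decide_eq_true (by omega)⟩
    omega
  · rintro rfl
    have := hw l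
    refine ⟨by omega, by omega, by omega, ?_⟩
    have h5 : D + 3 * (w + 1) - 4 < D + 3 * (w + 1) := by omega
    rw [decide_eq_true h5, Bool.true_and, ← Bool.not_eq_true,
      show D + 3 * (w + 1) - 4 = 3 * w + D - 1 by omega, collect_hears_leader hG hD]
    rintro ⟨u, -, h⟩
    have := of_decide_eq_true h
    have := hw u
    omega

theorem getMessageLength_haltsAt (hG : G.Connected) (hlead : ∀ v, lead v = true ↔ v = l) {D : ℕ}
    (hD : ∀ u, G.dist l u < D) {len : V → ℕ} {w : ℕ} (hw : ∀ u, len u ≤ w)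
    (hw' : ∃ u, len u = w) (v : V) :
    HaltsAt G (fun v => getMessageLength (lead v) D (len v))
      (waveTime D [true] + (3 * (w + 1) + D + waveTime D (toBits w.size w))) v w := by
  classical
  refine HaltsAt.bind (b := fun _ => w)
    (beepWave_haltsAt hG hlead (fun _ => [true]) fun v => ?_) (fun v => ?_) v
  · have := hD v
    simp only [waveTime]
    omega
  set B := collectBeep G l D (fun u i => decide (i < len u)) with hB
  have hex : ∀ v, ∃ t, CollectStop G l D (fun u i => decide (i < len u)) v t := fun v =>
    ⟨_, collectStop_of_le hw v⟩
  set s : V → ℕ := fun v => if v = l then D + 3 * (w + 1) else Nat.find (hex v) with hs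
  have hsl : s l = D + 3 * (w + 1) := if_pos rfl
  have hsv : ∀ v, v ≠ l → s v = Nat.find (hex v) := fun v hv => if_neg hv
  have hle : ∀ v, s v ≤ s l := by
    intro v
    by_cases hv : v = l
    · rw [hv]
    · rw [hsv v hv, hsl]
      exact Nat.find_min' _ (collectStop_of_le hw v)
  have hhalt : ∀ v, v ≠ l → CollectStop G l D (fun u i => decide (i < len u)) v (s v) := by
    intro v hv
    rw [hsv v hv]
    exact Nat.find_spec (hex v)
  have hl : ∀ v, v ≠ l → lead v = false := fun v hv => by
    rw [← Bool.not_eq_true, hlead]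
    exact hv
  have hbits : ofBits (toBits w.size w) = w := ofBits_toBits _ _ (Nat.lt_size_self _)
  have hp : (s l - D) / 3 - 1 = w := by
    rw [hsl]
    omega
  have hrun := bind_beepWave_haltsAt hG hlead
    (P := fun v => collectOnes (lead v) D (G.dist l v) (len v)) (B := B)
    (s := s) (out := s) (m := fun _ t => toBits ((t - D) / 3 - 1).size ((t - D) / 3 - 1))
    (dl := fun _ t m => 3 * (ofBits m + 1) + D + waveTime D m - t)
    (T := 3 * (w + 1) + D + waveTime D (toBits w.size w))
    (fun v t ht => by
      by_cases hv : v = l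
      · subst hv
        rw [(hlead v).2 rfl, collectOnes_record_leader hG hD hw hw' _ (by omega),
          if_neg (by omega), hB, collectBeep_leader]
        rfl
      · rw [hl v hv, collectOnes_record_of_ne hG hD len hv, if_neg]
        rw [hsv v hv] at ht
        exact Nat.find_min (hex v) ht)
    (fun v => by
      by_cases hv : v = l
      · subst hv
        rw [(hlead v).2 rfl, collectOnes_record_leader hG hD hw hw' _ (by omega), if_pos hsl]
      · rw [hl v hv, collectOnes_record_of_ne hG hD len hv, if_pos (hhalt v hv)])
    (fun v => (hle v).trans (Nat.le_add_right _ _))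
    (fun v hv t ht => collect_silent_of_quiescent (hhalt v hv) ht)
    (fun v t ht => by
      by_contra hc
      rw [Bool.not_eq_false] at hc
      have := collectBeep_lt hw hc
      omega)
    (fun v => by have := hle v; rw [hp, hbits]; omega)
    (fun v => by have := hD v; rw [hp, hsl]; simp only [waveTime]; omega)
  have := HaltsAt.bind_pure hrun (fun _ x => ofBits x.1) v
  simp only [bind_assoc_program, hp, hbits] at this
  exact this

end Graph

/-! ### Searching for the source IDs -/

theorem nodup_children {known : List ℕ} (h : known.Nodup) :
    (known.flatMap fun q => [2 * q, 2 * q + 1]).Nodup := by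
  rw [List.nodup_flatMap]
  refine ⟨fun q _ => by simp, List.Pairwise.imp ?_ h⟩
  intro a b hab
  simp only [Function.onFun, List.disjoint_cons_left, List.disjoint_nil_left, List.mem_cons,
    List.not_mem_nil, or_false, and_true]
  omega

theorem mem_children {known : List ℕ} {q : ℕ} :
    (q ∈ known.flatMap fun q => [2 * q, 2 * q + 1]) ↔ q / 2 ∈ known := by
  simp only [List.mem_flatMap, List.mem_cons, List.not_mem_nil, or_false]
  constructor
  · rintro ⟨a, ha, h⟩
    rwa [show q / 2 = a by omega]
  · intro h
    exact ⟨q / 2, h, by omega⟩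

theorem length_children (known : List ℕ) :
    (known.flatMap fun q => [2 * q, 2 * q + 1]).length = 2 * known.length := by
  simp [List.length_flatMap]
  omega

theorem filter_zip_map {α : Type} (f : α → Bool) (l : List α) :
    (((l.zip (l.map f)).filter fun c => c.2).map fun c => c.1) = l.filter f := by
  induction l with
  | nil => rfl
  | cons a l ih => cases h : f a <;> simp [h, ih]

theorem getD_flatMap {α : Type} (f : α → List Bool) (w : ℕ) (hf : ∀ a, (f a).length = w) :
    ∀ (l : List α) (i : ℕ) (hi : i < l.length) (j : ℕ), j < w →
      (l.flatMap f).getD (i * w + j) false = (f l[i]).getD j false := by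
  intro l
  induction l with
  | nil => intro i hi; simp at hi
  | cons a l ih =>
    intro i hi j hj
    rw [List.flatMap_cons]
    cases i with
    | zero =>
      rw [Nat.zero_mul, Nat.zero_add, List.getD_append _ _ _ _ (by rw [hf]; exact hj)]
      rfl
    | succ i =>
      rw [List.getD_append_right _ _ _ _ (by rw [hf, Nat.succ_mul]; omega), hf,
        show (i + 1) * w + j - w = i * w + j by rw [Nat.succ_mul]; omega,
        ih i (by simpa using hi) j hj]
      rfl

section Graph

variable {V : Type} {G : SimpleGraph V} {l : V} {lead : V → Bool}

theorem waveTime_eq (D : ℕ) (m : List Bool) : waveTime D m = 6 * m.length + 12 + D := by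
  rw [waveTime, encode_length]
  omega

open Classical in
-- Invariant: all nodes share one duplicate-free list of exactly the current prefixes. Its order
-- plays no role in the proof, only that it is common.
theorem searchIds_haltsAt (hG : G.Connected) (hlead : ∀ v, lead v = true ↔ v = l) {D : ℕ}
    (hD : ∀ u, G.dist l u < D) (ID m : V → ℕ) (S : Finset V) (r : ℕ) :
    ∀ known : List ℕ, known.Nodup → (∀ q, q ∈ known ↔ ∃ s ∈ S, ID s / 2 ^ r = q) →
    ∃ (T : ℕ) (ids : List ℕ), ids.Nodup ∧ (∀ q, q ∈ ids ↔ ∃ s ∈ S, ID s = q) ∧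
      T = r * (3 * D + 30) +
        18 * ∑ i ∈ Finset.range r, (S.image fun s => ID s / 2 ^ (i + 1)).card ∧
      ∀ v, HaltsAt G (fun v => searchIds (lead v) D
        (fun r => (if v ∈ S then some (m v) else none).map fun _ => ID v / 2 ^ r) r known) T v
          ids := by
  induction r with
  | zero =>
    intro known hn hk
    exact ⟨0, known, hn, by simpa using hk, by simp, haltsAt_pure fun _ => known⟩
  | succ r ih =>
    intro known hn hk
    set cand := known.flatMap fun q => [2 * q, 2 * q + 1] with hcand
    have hlen : cand.length = 2 * known.length := length_children known
    have hcard : known.length = (S.image fun s => ID s / 2 ^ (r + 1)).card := by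
      rw [← List.toFinset_card_of_nodup hn]
      congr 1
      ext q
      simp [hk]
    set pre : V → ℕ → Option ℕ := fun v r =>
      (if v ∈ S then some (m v) else none).map fun _ => ID v / 2 ^ r with hpre
    have hpre' : ∀ v q, pre v r = some q ↔ v ∈ S ∧ ID v / 2 ^ r = q := by
      intro v q
      by_cases hv : v ∈ S <;> simp [hpre, hv]
    obtain ⟨Z, hZ, hZrun⟩ := collectMessages_haltsAt hG hlead hD cand.length
      fun v => cand.map fun q => decide (pre v r = some q)
    have hZ' : Z l = cand.map fun q => decide (∃ s ∈ S, ID s / 2 ^ r = q) := by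
      rw [hZ]
      apply List.ext_getElem
      · simp
      · intro i h1 h2
        have hi : i < cand.length := by simpa using h2
        simp [List.getElem?_map, List.getElem?_eq_getElem hi, hpre']
    have hZlen : (Z l).length = cand.length := by rw [hZ']; simp
    have hnew : (((cand.zip (Z l)).filter fun c => c.2).map fun c => c.1) =
        cand.filter fun q => decide (∃ s ∈ S, ID s / 2 ^ r = q) := by
      rw [hZ', filter_zip_map]
    obtain ⟨T, ids, h1, h2, h3, h4⟩ := ih (cand.filter fun q => decide (∃ s ∈ S, ID s / 2 ^ r = q))
      ((nodup_children hn).filter _) (by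
        intro q
        rw [List.mem_filter, mem_children, hk, decide_eq_true_iff]
        refine ⟨fun h => h.2, fun h => ⟨?_, h⟩⟩
        obtain ⟨s, hs, rfl⟩ := h
        exact ⟨s, hs, by rw [pow_succ, Nat.div_div_eq_div_mul]⟩)
    -- With `q` known prefixes there are `2 q` candidates, and the round costs `(18 + D) + (6 q + D)
    -- + (12 q + 12 + D)`.
    refine ⟨waveTime D [true] + (3 * cand.length + D) + (waveTime D (Z l) + T), ids, h1, h2, ?_, ?_⟩
    · rw [h3, Finset.sum_range_succ, ← hcard, waveTime_eq, waveTime_eq, hZlen, hlen,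
        List.length_singleton]
      ring
    · intro v
      refine HaltsAt.bind (b := fun _ => ids) hZrun (fun v => ?_) v
      refine HaltsAt.bind (b := fun _ => ids) (beepWave_haltsAt hG hlead Z fun v => ?_)
        (fun v => ?_) v
      · have := hD v
        simp only [waveTime]
        omega
      · simp only [← hcand, hnew]
        exact h4 v

end Graph

/-! ### Counting the prefixes of the source IDs. -/

theorem sum_min_two_pow_le {k : ℕ} (hk : 0 < k) (b : ℕ) :
    ∑ j ∈ Finset.range b, min k (2 ^ j) ≤ 2 * k + k * (b - (Nat.log 2 k + 1)) := by
  have h1 : ∀ b, ∑ j ∈ Finset.range b, min k (2 ^ j) < 2 ^ b := by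
    intro b
    induction b with
    | zero => simp
    | succ b ih =>
      rw [Finset.sum_range_succ, pow_succ]
      have := min_le_right k (2 ^ b)
      omega
  have hlog : 2 ^ (Nat.log 2 k + 1) ≤ 2 * k := by
    rw [pow_succ, mul_comm]
    exact Nat.mul_le_mul_left 2 (Nat.pow_log_le_self 2 hk.ne')
  rcases Nat.le_total b (Nat.log 2 k + 1) with h | h
  · have h2 := h1 b
    have h3 : 2 ^ b ≤ 2 ^ (Nat.log 2 k + 1) := Nat.pow_le_pow_right (by norm_num) h
    omega
  · obtain ⟨d, rfl⟩ := Nat.exists_eq_add_of_le h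
    clear h
    rw [Nat.add_sub_cancel_left]
    induction d with
    | zero =>
      have := h1 (Nat.log 2 k + 1)
      rw [Nat.add_zero]
      omega
    | succ d ih =>
      rw [← Nat.add_assoc, Finset.sum_range_succ, Nat.mul_succ]
      have := min_le_left k (2 ^ (Nat.log 2 k + 1 + d))
      omega

/-- Short prefixes are few: the first `log k + 1` levels cost `2 k` together, and only the other
levels cost `k` each. This gives `k log (L / k)` instead of `k log L`. -/
theorem sum_card_prefixes_le {V : Type} (ID : V → ℕ) {S : Finset V} (hS : S.Nonempty) {b : ℕ}
    (hb : ∀ v, ID v < 2 ^ b) :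
    ∑ i ∈ Finset.range b, (S.image fun s => ID s / 2 ^ (i + 1)).card ≤
      2 * S.card + S.card * (b - (Nat.log 2 S.card + 1)) := by
  -- Reversal replaces the number of dropped bits by the number `j` of kept ones.
  rw [← Finset.sum_range_reflect]
  refine (Finset.sum_le_sum fun j hj => ?_).trans (sum_min_two_pow_le hS.card_pos b)
  rw [Finset.mem_range] at hj
  refine le_min Finset.card_image_le ?_
  rw [← Finset.card_range (2 ^ j)]
  refine Finset.card_le_card fun q hq => ?_
  obtain ⟨s, -, rfl⟩ := Finset.mem_image.1 hq
  rw [Finset.mem_range, Nat.div_lt_iff_lt_mul (by positivity), ← pow_add,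
    show j + (b - 1 - j + 1) = b by omega]
  exact hb s

/-! ### The complete algorithm. -/

section Graph

variable {V : Type} {G : SimpleGraph V} {l : V} {lead : V → Bool}

open Classical in
-- By injectivity of the IDs only one node writes into block `i`; all others contribute zeros, so
-- the superimposition loses nothing.
theorem collectBlocks_eq {ID m : V → ℕ} (hID : Function.Injective ID) {S : Finset V} {w : ℕ}
    {ids : List ℕ} {R : List Bool}
    (hR : R = (List.range (ids.length * w)).map fun i => decide (∃ u, (ids.flatMap fun q =>
      if q = ID u then toBits w ((if u ∈ S then some (m u) else none).getD 0)
      else List.replicate w false).getD i false = true))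
    {i : ℕ} (hi : i < ids.length) {s : V} (hs : s ∈ S) (hsi : ID s = ids[i]) :
    (R.drop (i * w)).take w = toBits w (m s) := by
  have hle : i * w + w ≤ ids.length * w := by
    rw [← Nat.succ_mul]
    exact Nat.mul_le_mul_right w hi
  apply List.ext_getElem
  · rw [toBits_length, List.length_take, List.length_drop, hR, List.length_map, List.length_range]
    omega
  · intro j h1 h2
    rw [toBits_length] at h2
    simp only [List.getElem_take, List.getElem_drop, hR, List.getElem_map, List.getElem_range]
    have hblock : ∀ u, (ids.flatMap fun q =>
        if q = ID u then toBits w ((if u ∈ S then some (m u) else none).getD 0)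
        else List.replicate w false).getD (i * w + j) false =
        (if ids[i] = ID u then toBits w ((if u ∈ S then some (m u) else none).getD 0)
        else List.replicate w false).getD j false := fun u =>
      getD_flatMap (fun q => if q = ID u then
        toBits w ((if u ∈ S then some (m u) else none).getD 0) else List.replicate w false) w
        (fun q => by split_ifs <;> simp [toBits_length]) ids i hi j h2
    simp only [hblock]
    rw [Bool.eq_iff_iff, decide_eq_true_iff]
    have hj : j < (toBits w (m s)).length := by rwa [toBits_length]
    constructor
    · rintro ⟨u, hu⟩
      by_cases h : ids[i] = ID u
      · obtain rfl : u = s := hID (by rw [← h, hsi])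
        rwa [if_pos h, if_pos hs, Option.getD_some, List.getD_eq_getElem _ _ hj] at hu
      · rw [if_neg h] at hu
        simp [h2] at hu
    · intro h
      refine ⟨s, ?_⟩
      rwa [if_pos hsi.symm, if_pos hs, Option.getD_some, List.getD_eq_getElem _ _ hj]

open Classical in
theorem multiBroadcastWithProvenance_haltsAt [Finite V] (hG : G.Connected)
    {electLeader : ℕ → Program ℕ} {ID m : V → ℕ} (hID : Function.Injective ID)
    (hl : ∀ v, ID v ≤ ID l) {T₀ : ℕ}
    (hT₀ : ∀ v, HaltsAt G (fun v => electLeader (ID v)) T₀ v (ID l))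
    {S : Finset V} (hS : S.Nonempty) :
    ∃ D T, D ≤ 2 * G.diam + 6 ∧ ∃ s ∈ S,
      T ≤ T₀ + 100 * D + 100 * (m s).size + 100 * (S.card * (m s).size) + 200 +
        ((ID l).size * (3 * D + 30) +
          18 * (2 * S.card + S.card * ((ID l).size - (Nat.log 2 S.card + 1)))) ∧
      ∀ v, HaltsAt G (fun v => multiBroadcastWithProvenance electLeader (ID v)
        (if v ∈ S then some (m v) else none)) T v (S.image fun s => (ID s, m s)) := by
  -- The source with the longest message determines the block width.
  obtain ⟨s₀, hs₀, hmax⟩ := S.exists_max_image (fun s => (m s).size) hS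
  set w := (m s₀).size with hw
  have hlead : ∀ v, (ID v == ID l) = true ↔ v = l := fun v => by simp [hID.eq_iff]
  obtain ⟨D, hDge, hDle, hDrun⟩ := estimateDiameter_haltsAt hG hlead
  have hD : ∀ u, G.dist l u < D := fun u => by have := hDge u; omega
  set src : V → Option ℕ := fun v => if v ∈ S then some (m v) else none with hsrc
  have hlen : ∀ u, (src u).elim 0 Nat.size ≤ w := by
    intro u
    by_cases hu : u ∈ S
    · simpa [hsrc, hu] using hmax u hu
    · simp [hsrc, hu]
  have hlenRun := getMessageLength_haltsAt hG hlead hD hlen ⟨s₀, by simp [hsrc, hs₀, hw]⟩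
  have hb : ∀ v, ID v < 2 ^ (ID l).size := fun v => (hl v).trans_lt (Nat.lt_size_self _)
  obtain ⟨T₃, ids, hnodup, hids, hT₃, hidsRun⟩ := searchIds_haltsAt hG hlead hD ID m S (ID l).size
    [0] (by simp) (by
      intro q
      simp only [List.mem_singleton]
      constructor
      · rintro rfl
        obtain ⟨s, hs⟩ := hS
        exact ⟨s, hs, Nat.div_eq_of_lt (hb s)⟩
      · rintro ⟨s, -, rfl⟩
        exact Nat.div_eq_of_lt (hb s))
  have hidslen : ids.length = S.card := by
    rw [← List.toFinset_card_of_nodup hnodup, ← Finset.card_image_of_injective S hID]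
    congr 1
    ext q
    simp [hids]
  obtain ⟨R, hR, hRrun⟩ := collectMessages_haltsAt hG hlead hD (ids.length * w) fun v =>
    ids.flatMap fun q => if q = ID v then toBits w ((src v).getD 0) else List.replicate w false
  have hRlen : (R l).length = ids.length * w := by rw [hR]; simp
  have hout : ((List.range ids.length).map fun i =>
      (ids.getD i 0, ofBits (((R l).drop (i * w)).take w))).toFinset =
      S.image fun s => (ID s, m s) := by
    have hval : ∀ i (hi : i < ids.length), ∀ s ∈ S, ID s = ids[i] →
        (ids.getD i 0, ofBits (((R l).drop (i * w)).take w)) = (ID s, m s) := by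
      intro i hi s hs hsi
      rw [collectBlocks_eq hID hR hi hs hsi, List.getD_eq_getElem _ _ hi, hsi,
        ofBits_toBits _ _ ((Nat.lt_size_self _).trans_le
          (Nat.pow_le_pow_right (by norm_num) (hmax s hs)))]
    ext x
    simp only [List.mem_toFinset, List.mem_map, List.mem_range, Finset.mem_image]
    constructor
    · rintro ⟨i, hi, rfl⟩
      obtain ⟨s, hs, hsi⟩ := (hids _).1 (List.getElem_mem hi)
      exact ⟨s, hs, (hval i hi s hs hsi).symm⟩
    · rintro ⟨s, hs, rfl⟩
      obtain ⟨i, hi, hsi⟩ := List.getElem_of_mem ((hids _).2 ⟨s, hs, rfl⟩)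
      exact ⟨i, hi, hval i hi s hs hsi.symm⟩
  refine ⟨D, T₀ + (D + waveTime D (toBits D.size D) +
    (waveTime D [true] + (3 * (w + 1) + D + waveTime D (toBits w.size w)) +
      (T₃ + (waveTime D [true] + (3 * (ids.length * w) + D) + waveTime D (R l))))), hDle, s₀, hs₀,
      ?_, ?_⟩
  · have h1 : D.size ≤ D := Nat.size_le.2 Nat.lt_two_pow_self
    have h2 : w.size ≤ w := Nat.size_le.2 Nat.lt_two_pow_self
    have h3 := sum_card_prefixes_le ID hS hb
    simp only [waveTime_eq, toBits_length, hRlen, hidslen, List.length_singleton, ← hw]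
    omega
  · intro v
    refine HaltsAt.bind (b := fun _ => S.image fun s => (ID s, m s)) hT₀ (fun v => ?_) v
    refine HaltsAt.bind (b := fun _ => S.image fun s => (ID s, m s)) hDrun (fun v => ?_) v
    refine HaltsAt.bind (b := fun _ => S.image fun s => (ID s, m s)) hlenRun (fun v => ?_) v
    refine HaltsAt.bind (b := fun _ => S.image fun s => (ID s, m s)) hidsRun (fun v => ?_) v
    refine HaltsAt.bind (b := fun _ => S.image fun s => (ID s, m s)) hRrun (fun v => ?_) v
    refine HaltsAt.of_eq (HaltsAt.bind_pure (beepWave_haltsAt hG hlead R fun v => ?_)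
      (fun _ x => ((List.range ids.length).map fun i =>
        (ids.getD i 0, ofBits ((x.1.drop (i * w)).take w))).toFinset) v) hout
    have := hD v
    simp only [waveTime]
    omega

end Graph

/-! ### The final time bound. -/

/-- The arithmetic behind the running time: `a = log L`, `μ = log M`, `κ = log k`. -/
theorem running_time_le {c d k a μ κ T T₀ D w b g : ℝ} (hd : 0 ≤ d) (hk : 1 ≤ k) (ha : 0 ≤ a)
    (hμ : 0 ≤ μ) (hκ : κ ≤ a) (hZ : 1 ≤ a + μ - κ) (hda : d ≤ d * a)
    (had : a ≤ k * (a + μ - κ) + d * a)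
    (hT₀ : T₀ ≤ c * ((d + 1) * (a + 1))) (hD : D ≤ 2 * d + 6) (hD0 : 0 ≤ D) (hb : b ≤ a + 1)
    (hw : w ≤ μ + 1) (hg : g ≤ a + 1 - κ)
    (hT : T ≤ T₀ + 100 * D + 100 * w + 100 * (k * w) + 200 +
      (b * (3 * D + 30) + 18 * (2 * k + k * g))) :
    T ≤ (3 * |c| + 2000) * (k * (a + μ - κ) + d * a) := by
  set Z := a + μ - κ with hZdef
  set X := k * Z + d * a with hX
  have hda0 : 0 ≤ d * a := by positivity
  have hkZ : k ≤ k * Z := by nlinarith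
  have hZX : Z ≤ k * Z := by nlinarith
  have h1 : (d + 1) * (a + 1) ≤ 3 * X := by nlinarith
  have hX1 : 1 ≤ X := by nlinarith
  have h2 : T₀ ≤ 3 * |c| * X := by
    calc T₀ ≤ c * ((d + 1) * (a + 1)) := hT₀
      _ ≤ |c| * ((d + 1) * (a + 1)) := by
        gcongr
        exact le_abs_self c
      _ ≤ |c| * (3 * X) := by gcongr
      _ = _ := by ring
  -- `κ ≤ a` gives `μ ≤ Z`, and `1 ≤ Z` absorbs the rounding.
  have hw2 : w ≤ 2 * Z := by linarith
  have h3 : k * w ≤ 2 * X := by nlinarith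
  have h4 : w ≤ 2 * X := by linarith
  have h5 : D ≤ 8 * X := by linarith
  have h6 : b * (3 * D + 30) ≤ 48 * ((d + 1) * (a + 1)) := by
    have : b * (3 * D + 30) ≤ (a + 1) * (48 * (d + 1)) :=
      mul_le_mul hb (by linarith) (by linarith) (by linarith)
    linarith
  have h7 : k * g ≤ 2 * X := by
    have : k * g ≤ k * (2 * Z) := by
      gcongr
      linarith
    linarith
  have h8 : k ≤ X := by linarith
  have : (3 * |c| + 2000) * X = 3 * |c| * X + 2000 * X := by ring
  linarith

theorem performsMultiBroadcastWithin_of_isLeaderElection {electLeader : ℕ → Program ℕ}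
    (h : IsLeaderElection electLeader) :
    ∃ C : ℝ, ∀ (V : Type) [Fintype V] (G : SimpleGraph V) (ID : V → ℕ) (S : Finset V) (m : V → ℕ)
      (L M : ℕ), G.Connected → Function.Injective ID → (∀ v, ID v < L) → S.Nonempty →
      (∀ s ∈ S, m s < M) → 2 * S.card ≤ L * M →
      ∃ T : ℕ, (T : ℝ) ≤ C * (S.card * Real.logb 2 ((L : ℝ) * M / S.card) +
          G.diam * Real.logb 2 L) ∧
        PerformsMultiBroadcastWithin (multiBroadcastWithProvenance electLeader) G ID S m T := by
  classical
  obtain ⟨c, hc⟩ := h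
  refine ⟨3 * |c| + 2000, fun V _ G ID S m L M hG hID hL hS hM hLM => ?_⟩
  obtain ⟨T₀, l, hl, hT₀, hrun⟩ := hc V G ID L hG hID hL
  obtain ⟨D, T, hD, s, hs, hT, hhalt⟩ :=
    multiBroadcastWithProvenance_haltsAt (m := m) hG hID hl hrun hS
  refine ⟨T, ?_, fun v => ?_⟩
  swap
  · have := (hhalt v).1
    unfold HasOutput at this ⊢
    convert this
  have hk : 0 < S.card := hS.card_pos
  have hL0 : 0 < L := (Nat.zero_le _).trans_lt (hL l)
  have hM0 : 0 < M := (Nat.zero_le _).trans_lt (hM s hs)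
  have hkL : S.card ≤ L := by
    rw [← Finset.card_range L, ← Finset.card_image_of_injective S hID]
    refine Finset.card_le_card fun q hq => ?_
    obtain ⟨v, -, rfl⟩ := Finset.mem_image.1 hq
    exact Finset.mem_range.2 (hL v)
  have hkR : (1 : ℝ) ≤ S.card := by exact_mod_cast hk
  have hLR : (1 : ℝ) ≤ L := by exact_mod_cast hL0
  have hMR : (1 : ℝ) ≤ M := by exact_mod_cast hM0
  have hlog : Real.logb 2 ((L : ℝ) * M / S.card) =
      Real.logb 2 L + Real.logb 2 M - Real.logb 2 S.card := by
    rw [Real.logb_div (by positivity) (by positivity), Real.logb_mul (by positivity) (by positivity)]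
  have hZ : 1 ≤ Real.logb 2 ((L : ℝ) * M / S.card) := by
    rw [Real.le_logb_iff_rpow_le (by norm_num) (by positivity), Real.rpow_one,
      le_div_iff₀ (by positivity)]
    exact_mod_cast hLM
  have ha : 0 ≤ Real.logb 2 L := Real.logb_nonneg (by norm_num) hLR
  have hμ : 0 ≤ Real.logb 2 M := Real.logb_nonneg (by norm_num) hMR
  have hκ0 : 0 ≤ Real.logb 2 S.card := Real.logb_nonneg (by norm_num) hkR
  have hκ : Real.logb 2 S.card ≤ Real.logb 2 L :=
    Real.logb_le_logb_of_le (by norm_num) (by positivity) (by exact_mod_cast hkL)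
  have hκlog : Real.logb 2 S.card ≤ (Nat.log 2 S.card + 1 : ℕ) := by
    rw [Real.logb_le_iff_le_rpow (by norm_num) (by positivity), Real.rpow_natCast]
    exact_mod_cast (Nat.lt_pow_succ_log_self (by norm_num) _).le
  have hb := size_le_logb (hL l)
  have hw := size_le_logb (hM s hs)
  have hg : (((ID l).size - (Nat.log 2 S.card + 1) : ℕ) : ℝ) ≤
      Real.logb 2 L + 1 - Real.logb 2 S.card := by
    rcases Nat.le_total (Nat.log 2 S.card + 1) (ID l).size with hle | hle
    · rw [Nat.cast_sub hle]
      linarith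
    · rw [Nat.sub_eq_zero_of_le hle, Nat.cast_zero]
      linarith
  -- A single node needs separate care: `D log L` vanishes there, but `k = 1` makes `k log (L M /
  -- k)` at least `log L`. Otherwise `D log L` dominates both `D` and `log L`.
  have hsmall : (G.diam = 0 ∧ S.card = 1) ∨ (1 ≤ G.diam ∧ 2 ≤ L) := by
    rcases Nat.eq_zero_or_pos G.diam with hd | hd
    · left
      refine ⟨hd, le_antisymm (Finset.card_le_one.2 fun u _ v _ => ?_) hk⟩
      have := dist_le_diam_of_finite hG u v
      exact hG.dist_eq_zero_iff.1 (by omega)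
    · right
      refine ⟨hd, ?_⟩
      have := hG.nonempty
      obtain ⟨u, v, huv⟩ := G.exists_dist_eq_diam
      by_contra hc
      have h1 := hL u
      have h2 := hL v
      have : u = v := hID (by omega)
      subst this
      simp at huv
      omega
  rw [hlog] at hZ ⊢
  refine running_time_le (c := c) (T₀ := T₀) (D := D) (w := (m s).size) (b := (ID l).size)
    (g := ((ID l).size - (Nat.log 2 S.card + 1) : ℕ)) (Nat.cast_nonneg _) hkR ha hμ hκ hZ ?_ ?_ hT₀
    (by exact_mod_cast hD) (Nat.cast_nonneg _) hb hw hg (by exact_mod_cast hT)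
  · rcases hsmall with ⟨hd, -⟩ | ⟨hd, hL2⟩
    · simp [hd]
    · refine le_mul_of_one_le_right (Nat.cast_nonneg _) ?_
      rw [Real.le_logb_iff_rpow_le (by norm_num) (by positivity), Real.rpow_one]
      exact_mod_cast hL2
  · rcases hsmall with ⟨hd, hk1⟩ | ⟨hd, hL2⟩
    · simp [hd, hk1, hμ]
    · have h1 : Real.logb 2 L ≤ G.diam * Real.logb 2 L :=
        le_mul_of_one_le_left ha (by exact_mod_cast hd)
      have h2 : 0 ≤ (S.card : ℝ) * (Real.logb 2 L + Real.logb 2 M - Real.logb 2 S.card) := by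
        nlinarith
      linarith

end Beep

theorem mainTheorem1 :
    (∃ electLeader : ℕ → Beep.Program ℕ, Beep.IsLeaderElection electLeader) ∧
    ∀ electLeader : ℕ → Beep.Program ℕ, Beep.IsLeaderElection electLeader →
      ∃ C : ℝ, ∀ (V : Type) [Fintype V] (G : SimpleGraph V) (ID : V → ℕ) (S : Finset V) (m : V → ℕ)
        (L M : ℕ),
        G.Connected → Function.Injective ID → (∀ v, ID v < L) →
        S.Nonempty → (∀ s ∈ S, m s < M) → 2 * S.card ≤ L * M →
        ∃ T : ℕ,
          (T : ℝ) ≤ C * (S.card * Real.logb 2 ((L : ℝ) * M / S.card) + G.diam * Real.logb 2 L) ∧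
          Beep.PerformsMultiBroadcastWithin (Beep.multiBroadcastWithProvenance electLeader)
            G ID S m T :=
  ⟨⟨Beep.elect, Beep.isLeaderElection_elect⟩, fun _ h =>
    Beep.performsMultiBroadcastWithin_of_isLeaderElection h⟩
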